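/- For a prime $p$ and a group $G$, let $\hat G^p$ be the pro-$p$ completion of $G$, i.e. the inverse limit of the quotients of $G$ by its normal subgroups of $p$-power index, and let $c_G^p:G\to\hat G^p$ be the completion map. Let $\mathcal C$ be the class of all groups $G$ such that, for every prime $p$ and every $n\ge 0$, the homomorphism $H^n_{\rm cont}(\hat G^p,\mathbb Z/p)\to H^n(G,\mathbb Z/p)$ induced by $c_G^p$ is an isomorphism ($\mathbb Z/p$ being the discrete trivial module; $H^n_{\rm cont}$ is continuous cohomology and $H^n$ is cohomology of the discrete group). A group is residually $p$-finite if every nontrivial element survives in some quotient of finite $p$-power order. Let $N=\mathbb Z\oplus\mathbb Z$, and let $G_1=N\rtimes\mathbb Z$ and $G_2=N\rtimes\mathbb Z$, where $1\in\mathbb Z$ acts on $N$ by $(a,b)\mapsto(a+b,b)$ and by $(a,b)\mapsto(a,a+b)$, respectively. Let $G=G_1*_N G_2$ be the free product with amalgamated subgroup $N$. Then: 1. $G_1\cong G_2$, and these groups are finitely generated, torsion-free and nilpotent of class exactly $2$. 2. $N$ is finitely generated and normal in $G_1$ and in $G_2$; the groups $G_1/N$, $G_2/N$, $G_1$ and $G_2$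 all lie in $\mathcal C$; and $G_1$, $G_2$ are residually $p$-finite for every prime $p$. However, $N$ is not central in $G_1$, not central in $G_2$, and not cyclic. 3. For every prime $p$, $\hat G^p$ is isomorphic, as a topological group, to $\hat F_2^p$, the free pro-$p$ group on two generators (the pro-$p$ completion of the free group $F_2$ on two generators); $H^2_{\rm cont}(\hat G^p,\mathbb Z/p)=0$; and $H^2(G,\mathbb Z/p)\ne 0$. 4. Consequently $G\notin\mathcal C$. Thus the hypothesis "central" cannot be dropped from the theorem "if $A$ is a finitely generated central subgroup common to $G_1$ and $G_2$, and $G_1/A,G_2/A\in\mathcal C$, then $G_1*_AG_2\in\mathcal C$", and the hypothesis "cyclic" cannot be dropped from the theorem "if $A$ is a cyclic subgroup common to $G_1$ and $G_2$, where $G_1,G_2\in\mathcal C$ are residually $p$-finite for every prime $p$, then $G_1*_AG_2\in\mathcal C$". -/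

import Mathlib

open CategoryTheory

/-! ### Pro-`p` completions -/

/-- The normal subgroups of `G` whose index is a (finite) power of `p`. -/
abbrev PPowerIndexNormalSubgroup (p : ℕ) (G : Type) [Group G] : Type :=
  {N : FiniteIndexNormalSubgroup G // ∃ k : ℕ, N.toSubgroup.index = p ^ k}

/-- The inverse system of the quotients `G ⧸ N`, where `N` runs over the normal subgroups of `G`
of `p`-power index. -/
def pFiniteQuotientDiagram (p : ℕ) (G : Type) [Group G] :
    PPowerIndexNormalSubgroup p G ⥤ ProfiniteGrp.{0} :=
  (Subtype.mono_coe (fun N : FiniteIndexNormalSubgroup G =>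
    ∃ k : ℕ, N.toSubgroup.index = p ^ k)).functor ⋙
    ProfiniteGrp.ProfiniteCompletion.diagram (GrpCat.of G)

/-- The pro-`p` completion of `G`: the inverse limit of the quotients of `G` of `p`-power order. -/
abbrev ProPCompletion (p : ℕ) (G : Type) [Group G] : ProfiniteGrp.{0} :=
  ProfiniteGrp.limit (pFiniteQuotientDiagram p G)

/-- The completion map from `G` to its pro-`p` completion. -/
def toProPCompletion (p : ℕ) (G : Type) [Group G] : G →* ProPCompletion p G where
  toFun x := ⟨fun _ => QuotientGroup.mk x, fun _ _ _ => rfl⟩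
  map_one' := rfl
  map_mul' _ _ := rfl

/-- `G` is residually `p`-finite: every nontrivial element survives in some quotient of `G` whose
order is a finite power of `p`. -/
def IsResiduallyPFinite (p : ℕ) (G : Type) [Group G] : Prop :=
  ∀ g : G, g ≠ 1 → ∃ N : PPowerIndexNormalSubgroup p G, g ∉ N.1.toSubgroup

/-! ### Continuous and discrete cohomology with coefficients in `ℤ/p` -/

/-- `ℤ/p` (discrete) as a trivial module over the topological group `Γ`. -/
abbrev trivialTopRep (p : ℕ) (Γ : Type) [Group Γ] [TopologicalSpace Γ] [IsTopologicalGroup Γ] :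
    TopRep (ZMod p) Γ :=
  TopRep.of (ContRepresentation.trivial (ZMod p) Γ (ZMod p))

/-- The complex of homogeneous continuous cochains of `Γ` with values in `ℤ/p`. Its `n`-th term is
the module of `Γ`-invariant elements of `C(Γ, C(Γ, … C(Γ, ℤ/p)))` (`n + 1` variables). -/
noncomputable abbrev contCochains (p : ℕ) (Γ : Type) [Group Γ] [TopologicalSpace Γ]
    [IsTopologicalGroup Γ] : CochainComplex (TopModuleCat (ZMod p)) ℕ :=
  TopRep.homogeneousCochains (trivialTopRep p Γ)

/-- The continuous cohomology `Hⁿ_cont(Γ, ℤ/p)`. -/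
noncomputable abbrev ContH (p : ℕ) (Γ : Type) [Group Γ] [TopologicalSpace Γ]
    [IsTopologicalGroup Γ] (n : ℕ) : TopModuleCat (ZMod p) :=
  continuousCohomology n (trivialTopRep p Γ)

/-- The cohomology `Hⁿ(G, ℤ/p)` of the discrete group `G`. -/
noncomputable abbrev DiscH (p : ℕ) (G : Type) [Group G] (n : ℕ) : ModuleCat (ZMod p) :=
  groupCohomology (Rep.trivial (ZMod p) G (ZMod p)) n

/-- The value `F (g 0) (g 1) … (g (n - 1))` of an iterated function
`F ∈ C(Γ, C(Γ, … C(Γ, ℤ/p)))` of `n` variables. -/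
def evalTuple {p : ℕ} {Γ : Type} [Group Γ] [TopologicalSpace Γ] [IsTopologicalGroup Γ] :
    (n : ℕ) → TopRep.resolutionX (trivialTopRep p Γ) n → (Fin n → Γ) → ZMod p
  | 0, m, _ => m
  | n + 1, F, g =>
    evalTuple n ((F : C(Γ, TopRep.resolutionX (trivialTopRep p Γ) n)) (g 0)) (Fin.tail g)

lemma evalTuple_add {p : ℕ} {Γ : Type} [Group Γ] [TopologicalSpace Γ] [IsTopologicalGroup Γ] :
    ∀ (n : ℕ) (F F' : TopRep.resolutionX (trivialTopRep p Γ) n) (g : Fin n → Γ),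
      evalTuple n (F + F') g = evalTuple n F g + evalTuple n F' g
  | 0, _, _, _ => rfl
  | n + 1, _, _, _ => evalTuple_add n _ _ _

lemma evalTuple_smul {p : ℕ} {Γ : Type} [Group Γ] [TopologicalSpace Γ] [IsTopologicalGroup Γ] :
    ∀ (n : ℕ) (a : ZMod p) (F : TopRep.resolutionX (trivialTopRep p Γ) n) (g : Fin n → Γ),
      evalTuple n (a • F) g = a • evalTuple n F g
  | 0, _, _, _ => rfl
  | n + 1, a, _, _ => evalTuple_smul n a _ _

lemma evalTuple_sub {p : ℕ} {Γ : Type} [Group Γ] [TopologicalSpace Γ] [IsTopologicalGroup Γ]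
    (n : ℕ) (F F' : TopRep.resolutionX (trivialTopRep p Γ) n) (g : Fin n → Γ) :
    evalTuple n (F - F') g = evalTuple n F g - evalTuple n F' g := by
  rw [eq_sub_iff_add_eq, ← evalTuple_add, sub_add_cancel]

lemma evalTuple_d {p : ℕ} {Γ : Type} [Group Γ] [TopologicalSpace Γ] [IsTopologicalGroup Γ] :
    ∀ (n : ℕ) (F : TopRep.resolutionX (trivialTopRep p Γ) n) (g : Fin (n + 1) → Γ),
      evalTuple (n + 1) ((TopRep.d (trivialTopRep p Γ) n).hom F) g =
        ∑ j : Fin (n + 1), (-1) ^ (j : ℕ) * evalTuple n F (g ∘ j.succAbove)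
  | 0, F, g => by
      rw [Fin.sum_univ_succ]
      simp
      rfl
  | n + 1, F, g => by
      have h := evalTuple_d n
        ((F : C(Γ, TopRep.resolutionX (trivialTopRep p Γ) n)) (g 0)) (Fin.tail g)
      rw [TopRep.hom_d_succ, Fin.sum_univ_succ]
      change evalTuple (n + 1) (F - _) (Fin.tail g) = _
      rw [evalTuple_sub]
      change _ - evalTuple (n + 1) ((TopRep.d (trivialTopRep p Γ) n).hom
        ((F : C(Γ, TopRep.resolutionX (trivialTopRep p Γ) n)) (g 0))) (Fin.tail g) = _
      rw [h, sub_eq_add_neg, ← Finset.sum_neg_distrib]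
      congr 1
      · simp; rfl
      · refine Finset.sum_congr rfl fun j _ => ?_
        rw [Fin.val_succ, pow_succ, mul_neg_one, neg_mul]
        refine congrArg (fun y => -((-1 : ZMod p) ^ (j : ℕ) * y))
          (congrArg (evalTuple (p := p) (Γ := Γ) n (F (g 0))) ?_)
        funext i
        simp [Fin.tail]

lemma evalTuple_rho {p : ℕ} {Γ : Type} [Group Γ] [TopologicalSpace Γ] [IsTopologicalGroup Γ] :
    ∀ (n : ℕ) (x : Γ) (F : TopRep.resolutionX (trivialTopRep p Γ) n) (g : Fin n → Γ),
      evalTuple n ((TopRep.resolutionX (trivialTopRep p Γ) n).ρ x F) g =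
        evalTuple n F (fun i => x⁻¹ * g i)
  | 0, _, _, _ => rfl
  | n + 1, x, _, _ => evalTuple_rho n x _ _

/-- Pull-back of a homogeneous continuous `n`-cochain `σ` of `Γ` along `c : G → Γ`, written as an
inhomogeneous cochain of the discrete group `G`:
`(g₁, …, gₙ) ↦ σ (1, c(g₁), c(g₁g₂), …, c(g₁⋯gₙ))`. -/
def pullbackCochain {p : ℕ} {Γ : Type} [Group Γ] [TopologicalSpace Γ] [IsTopologicalGroup Γ]
    {G : Type} [Group G] (c : G →* Γ) (n : ℕ) :
    (contCochains p Γ).X n →ₗ[ZMod p] ((Fin n → G) → ZMod p) where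
  toFun σ g := evalTuple (n + 1) σ.1 (fun i => c (Fin.partialProd g i))
  map_add' σ τ := funext fun g => evalTuple_add (n + 1) σ.1 τ.1 _
  map_smul' a σ := funext fun g => evalTuple_smul (n + 1) a σ.1 _

lemma pullbackCochain_d {p : ℕ} {Γ : Type} [Group Γ] [TopologicalSpace Γ] [IsTopologicalGroup Γ]
    {G : Type} [Group G] (c : G →* Γ) (i : ℕ) (σ : (contCochains p Γ).X i) :
    pullbackCochain c (i + 1) (((contCochains p Γ).d i (i + 1)).hom σ) =
      (inhomogeneousCochains.d (Rep.trivial (ZMod p) G (ZMod p)) i).hom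
        (pullbackCochain c i σ) := by
  funext g
  change evalTuple (i + 2) (((contCochains p Γ).d i (i + 1)).hom σ).1
      (fun k => c (Fin.partialProd g k)) = _
  rw [TopRep.homogeneousCochains.d_eq]
  refine (evalTuple_d (i + 1) σ.1 _).trans ?_
  rw [Fin.sum_univ_succ]
  change _ = evalTuple (i + 1) σ.1 (fun k => c (Fin.partialProd (Fin.tail g) k)) +
      ∑ j : Fin (i + 1), (-1 : ZMod p) ^ ((j : ℕ) + 1) *
        evalTuple (i + 1) σ.1 (fun k => c (Fin.partialProd (Fin.contractNth j (· * ·) g) k))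
  congr 1
  · rw [Fin.val_zero, pow_zero, one_mul]
    have h := evalTuple_rho (i + 1) (c (g 0)) σ.1 (fun k => c (Fin.partialProd g (Fin.succ k)))
    have hσ := σ.2 (c (g 0))
    refine Eq.trans (Eq.trans ?_ h) ?_
    · exact congrArg (fun y => evalTuple (i + 1) y _) hσ.symm
    · refine congrArg (evalTuple (i + 1) σ.1) (funext fun k => ?_)
      rw [Fin.partialProd_succ', map_mul, inv_mul_cancel_left]
  · refine Finset.sum_congr rfl fun j _ => ?_
    rw [Fin.val_succ, Fin.partialProd_contractNth]
    rfl

/-- The cochain map from the (underlying complex of the) continuous cochains of `Γ` to the cochains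
of the discrete group `G` induced by a homomorphism `c : G → Γ`. -/
noncomputable def pullbackCochains {p : ℕ} {Γ : Type} [Group Γ] [TopologicalSpace Γ]
    [IsTopologicalGroup Γ] {G : Type} [Group G] (c : G →* Γ) :
    ((forget₂ (TopModuleCat (ZMod p)) (ModuleCat (ZMod p))).mapHomologicalComplex _).obj
      (contCochains p Γ) ⟶
    groupCohomology.inhomogeneousCochains (Rep.trivial (ZMod p) G (ZMod p)) where
  f n := ModuleCat.ofHom (pullbackCochain c n)
  comm' i j (hij : i + 1 = j) := by
    subst hij
    rw [groupCohomology.inhomogeneousCochains.d_def]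
    exact ModuleCat.hom_ext (LinearMap.ext fun σ => (pullbackCochain_d c i σ).symm)

/-- The homomorphism `Hⁿ_cont(Γ, ℤ/p) → Hⁿ(G, ℤ/p)` induced by a homomorphism `c` from the discrete
group `G` to the topological group `Γ`. -/
noncomputable def cohomologyComparison (p : ℕ) {Γ : Type} [Group Γ] [TopologicalSpace Γ]
    [IsTopologicalGroup Γ] {G : Type} [Group G] (c : G →* Γ) (n : ℕ) :
    (forget₂ (TopModuleCat (ZMod p)) (ModuleCat (ZMod p))).obj (ContH p Γ n) ⟶ DiscH p G n :=
  (((contCochains p Γ).sc n).mapHomologyIso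
      (forget₂ (TopModuleCat (ZMod p)) (ModuleCat (ZMod p)))).inv ≫
    HomologicalComplex.homologyMap (pullbackCochains c) n

/-- The class `𝒞`: the groups `G` such that, for every prime `p` and every `n ≥ 0`, the
homomorphism `Hⁿ_cont(Ĝ^p, ℤ/p) → Hⁿ(G, ℤ/p)` induced by the completion map is an isomorphism. -/
def IsInClassC (G : Type) [Group G] : Prop :=
  ∀ p : ℕ, p.Prime → ∀ n : ℕ,
    Function.Bijective (cohomologyComparison p (toProPCompletion p G) n).hom

/-! ### The groups of the example -/

/-- `N = ℤ ⊕ ℤ`, written multiplicatively. -/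
abbrev RankTwoLattice : Type := Multiplicative (ℤ × ℤ)

/-- The automorphisms `(a, b) ↦ (a + b, b)` (index `0`) and `(a, b) ↦ (a, a + b)` (index `1`). -/
def shearEquiv : Fin 2 → (ℤ × ℤ) ≃+ (ℤ × ℤ)
  | 0 =>
    { toFun := fun x => (x.1 + x.2, x.2)
      invFun := fun x => (x.1 - x.2, x.2)
      left_inv := fun x => by simp
      right_inv := fun x => by simp
      map_add' := fun x y => by ext <;> simp; ring }
  | 1 =>
    { toFun := fun x => (x.1, x.1 + x.2)
      invFun := fun x => (x.1, x.2 - x.1)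
      left_inv := fun x => by simp
      right_inv := fun x => by simp
      map_add' := fun x y => by ext <;> simp; ring }

/-- The shears as elements of the automorphism group of `N`. -/
def shear (i : Fin 2) : MulAut RankTwoLattice := AddEquiv.toMultiplicative (shearEquiv i)

/-- The group `G₁` (index `0`), respectively `G₂` (index `1`): the semidirect product `N ⋊ ℤ` in
which `1 ∈ ℤ` acts on `N` by the corresponding shear. -/
abbrev ShearGroup (i : Fin 2) : Type :=
  RankTwoLattice ⋊[zpowersHom (MulAut RankTwoLattice) (shear i)] Multiplicative ℤ

/-- The inclusion of `N` in `G₁`, respectively `G₂`. -/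
abbrev latticeInclusion (i : Fin 2) : RankTwoLattice →* ShearGroup i := SemidirectProduct.inl

instance latticeInclusion_range_normal (i : Fin 2) : (latticeInclusion i).range.Normal := by
  rw [SemidirectProduct.range_inl_eq_ker_rightHom]
  infer_instance

/-- The free product with amalgamation `G = G₁ *_N G₂`. -/
abbrev ShearAmalgam : Type := Monoid.PushoutI latticeInclusion

/-! Two mechanisms drive the example. First, in `G` each of the two basis vectors of `N` is a
commutator of the other with a stable letter. In a nilpotent quotient both therefore lie in every
term of the lower central series, so `N` dies in every finite `p`-quotient
(`map_lattice_of_isNilpotent`) and the pro-`p` completion sees only `G/N`, which is free of rank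
two. A locally constant 2-cocycle is a coboundary because the finite `p`-extension it defines
receives a lift from the free group (`contH_two_subsingleton`). Second, the discrete group still
sees `N`: the shears lift to automorphisms of the Heisenberg group fixing its centre, so `Heis ℤ ⋊
F₂` is a central extension of `N ⋊ F₂` by `ℤ`. Its class, pulled back to `G` and reduced mod `p`, is
nonzero because commuting elements of `N` have noncommuting lifts (`discH_two_nontrivial`).

Most of the work is to put the factors in `𝒞`. Continuous cochains of the completion are exactly the
cochains of the group that factor through a quotient of `p`-power order. By dimension shifting, the
comparison map is bijective as soon as the modules of locally constant functions on the group are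
acyclic (`exists_isLC_sub_of_acyclic`, `isInClassC_of_acyclic`).

Both factors are the integral Heisenberg group, built from the trivial group by three successive
extensions by `ℤ`. By `acyclic_of_ker`, acyclicity survives such an extension once `t - 1` is
surjective on invariants. For locally constant functions this is a difference equation in one
coordinate. A periodic right-hand side has a periodic solution with period multiplied by `p`,
because the coefficients are killed by `p` (`intPrimitive_congr`). -/

/-! ### Inhomogeneous cochains of unbundled representations -/

/-- The differential of inhomogeneous cochains with values in a representation. -/
noncomputable def coboundary {k G M : Type} [CommRing k] [Group G] [AddCommGroup M] [Module k M]
    (ρ : Representation k G M) (n : ℕ) :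
    ((Fin n → G) → M) →ₗ[k] ((Fin (n + 1) → G) → M) :=
  (inhomogeneousCochains.d (Rep.of ρ) n).hom

/-- Every cocycle of positive degree is a coboundary. -/
def Acyclic {k G M : Type} [CommRing k] [Group G] [AddCommGroup M] [Module k M]
    (ρ : Representation k G M) : Prop :=
  ∀ n : ℕ, ∀ f : (Fin (n + 1) → G) → M, coboundary ρ (n + 1) f = 0 →
    ∃ g : (Fin n → G) → M, coboundary ρ n g = f

section Cochains

variable {k G M : Type} [CommRing k] [Group G] [AddCommGroup M] [Module k M]

lemma coboundary_apply (ρ : Representation k G M) (n : ℕ) (f : (Fin n → G) → M)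
    (g : Fin (n + 1) → G) :
    coboundary ρ n f g = ρ (g 0) (f (Fin.tail g)) +
      ∑ j : Fin (n + 1), (-1 : k) ^ ((j : ℕ) + 1) • f (Fin.contractNth j (· * ·) g) := rfl

lemma coboundary_coboundary (ρ : Representation k G M) (n : ℕ) (f : (Fin n → G) → M) :
    coboundary ρ (n + 1) (coboundary ρ n f) = 0 :=
  congrArg (fun φ => φ.hom f)
    (groupCohomology.inhomogeneousCochains.d_comp_d (n := n) (A := Rep.of ρ))

lemma coboundary_naturality {H M' : Type} [Group H] [AddCommGroup M'] [Module k M']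
    (ρ : Representation k G M) (ρ' : Representation k H M') (i : H →* G) (L : M →ₗ[k] M')
    (hL : ∀ h m, L (ρ (i h) m) = ρ' h (L m)) (n : ℕ) (f : (Fin n → G) → M) :
    coboundary ρ' n (fun h => L (f (fun j => i (h j)))) =
      fun h => L (coboundary ρ n f (fun j => i (h j))) := by
  funext h
  have hc : ∀ j : Fin (n + 1), (fun l => i (Fin.contractNth j (· * ·) h l)) =
      Fin.contractNth j (· * ·) (fun l => i (h l)) := fun j =>
    Fin.comp_contractNth (· * ·) (· * ·) (fun a b => map_mul i a b) j h
  simp only [coboundary_apply, map_add, map_sum, map_smul, hL, ← hc]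
  rfl

lemma coboundary_map {M' : Type} [AddCommGroup M'] [Module k M']
    {ρ : Representation k G M} {ρ' : Representation k G M'} (L : M →ₗ[k] M')
    (hL : ∀ g m, L (ρ g m) = ρ' g (L m)) {n : ℕ} (f : (Fin n → G) → M) :
    coboundary ρ' n (fun g => L (f g)) = fun g => L (coboundary ρ n f g) :=
  coboundary_naturality ρ ρ' (MonoidHom.id G) L hL n f

/-- The bracket is the differential of `g ↦ f (Fin.cons y g)` except in its leading term, where `g
0` is multiplied into `y` instead of acting on the value. Matching these two terms turns insertion
of `y` into a contracting homotopy. -/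
lemma coboundary_cons (ρ : Representation k G M) (n : ℕ) (f : (Fin (n + 1) → G) → M)
    (y : G) (g : Fin (n + 1) → G) :
    coboundary ρ (n + 1) f (Fin.cons y g) = ρ y (f g) -
      (f (Fin.cons (y * g 0) (Fin.tail g)) + ∑ j : Fin (n + 1), (-1 : k) ^ ((j : ℕ) + 1) •
        f (Fin.cons y (Fin.contractNth j (· * ·) g))) := by
  have h0 : Fin.contractNth 0 (· * ·) (Fin.cons y g : Fin (n + 2) → G) =
      Fin.cons (y * g 0) (Fin.tail g) := by
    funext l
    refine Fin.cases ?_ (fun l => ?_) l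
    · simp [Fin.contractNth]
    · simp [Fin.contractNth, Fin.tail]
  have hs : ∀ j : Fin (n + 1), Fin.contractNth j.succ (· * ·) (Fin.cons y g : Fin (n + 2) → G) =
      Fin.cons y (Fin.contractNth j (· * ·) g) := by
    intro j
    funext l
    refine Fin.cases ?_ (fun l => ?_) l
    · simp [Fin.contractNth]
    · simp [Fin.contractNth]
  rw [coboundary_apply, Fin.sum_univ_succ, h0]
  simp only [hs, Fin.cons_zero, Fin.tail_cons, Fin.val_zero, Fin.val_succ]
  rw [sub_eq_add_neg, neg_add, ← Finset.sum_neg_distrib]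
  congr 2
  · simp
  · refine Finset.sum_congr rfl fun j _ => ?_
    rw [pow_succ, mul_neg_one, neg_smul]

/-- If the cochain `h` satisfies the contraction formula for `f` after applying `e`, then
`e (d h) = e f` as soon as `f` is a cocycle. -/
lemma contraction_apply {V : Type} [AddCommGroup V] [Module k V] (ρ : Representation k G M)
    (n : ℕ) (f : (Fin (n + 1) → G) → M) (h : (Fin n → G) → M) (y : G) (e e' : M →ₗ[k] V)
    (he : ∀ m, e (ρ y m) = e' m) (hh : ∀ g, e' (h g) = e (f (Fin.cons y g)))
    (hρ : ∀ z g, e' (ρ z (h g)) = e (f (Fin.cons (y * z) g))) (g : Fin (n + 1) → G) :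
    e' (coboundary ρ n h g) = e' (f g) - e (coboundary ρ (n + 1) f (Fin.cons y g)) := by
  rw [coboundary_cons, coboundary_apply]
  simp only [map_add, map_sub, map_sum, map_smul, he, hh, hρ]
  abel

lemma Acyclic.of_subsingleton [Subsingleton G] (ρ : Representation k G M) : Acyclic ρ := by
  intro n f hf
  have hρ : ∀ g, ρ g = LinearMap.id := fun g => by
    rw [Subsingleton.elim g 1, map_one]; rfl
  refine ⟨fun g => f (Fin.cons 1 g), funext fun g => ?_⟩
  have := contraction_apply ρ n f (fun g => f (Fin.cons 1 g)) 1 LinearMap.id LinearMap.id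
    (fun m => by simp) (fun g => rfl)
    (fun z g => by rw [hρ, Subsingleton.elim z 1, mul_one]; rfl) g
  rw [hf] at this
  simpa using this

lemma Acyclic.of_equiv {H M' : Type} [Group H] [AddCommGroup M'] [Module k M']
    {ρ : Representation k G M} {ρ' : Representation k H M'} (i : H ≃* G) (L : M ≃ₗ[k] M')
    (hL : ∀ h m, L (ρ (i h) m) = ρ' h (L m)) (hρ : Acyclic ρ) : Acyclic ρ' := by
  intro n f hf
  have hL' : ∀ g m, L.symm (ρ' (i.symm g) m) = ρ g (L.symm m) := fun g m => by
    rw [LinearEquiv.symm_apply_eq, ← MulEquiv.apply_symm_apply i g, hL]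
    simp
  obtain ⟨u, hu⟩ := hρ n (fun g => L.symm (f (fun j => i.symm (g j)))) (by
    have := coboundary_naturality ρ' ρ i.symm.toMonoidHom L.symm.toLinearMap hL' (n + 1) f
    refine this.trans ?_
    rw [hf]
    funext g
    simp)
  refine ⟨fun h => L (u (fun j => i (h j))), ?_⟩
  refine (coboundary_naturality ρ ρ' i.toMonoidHom L.toLinearMap hL n u).trans ?_
  rw [hu]
  funext g
  simp

end Cochains

/-! ### The regular representation on functions -/

section Regular

variable (k G V : Type) [CommRing k] [Group G] [AddCommGroup V] [Module k V]

/-- The action of `G` on functions `G → V` by right translation. -/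
def rightRegular : Representation k G (G → V) where
  toFun g := LinearMap.funLeft k V (· * g)
  map_one' := by ext; simp [LinearMap.funLeft_apply]
  map_mul' g h := by ext; simp [LinearMap.funLeft_apply, mul_assoc]

variable {k G V}

lemma rightRegular_apply (g : G) (F : G → V) (x : G) : rightRegular k G V g F x = F (x * g) := rfl

/-- Write each element as a chosen representative of its left coset times an element of `K`, and
keep the second factor. Right multiplication by `K` does not change the representative. -/
lemma exists_equivariant_retraction {K : Type} [Group K] (i : K →* G)
    (hi : Function.Injective i) : ∃ π : G → K, ∀ x y, π (x * i y) = π x * y := by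
  have h : ∀ x : G, ∃ y : K, i y = (Quotient.out (QuotientGroup.mk x : G ⧸ i.range))⁻¹ * x :=
    fun x => QuotientGroup.eq.1 (QuotientGroup.out_eq' (QuotientGroup.mk x : G ⧸ i.range))
  choose π hπ using h
  refine ⟨π, fun x y => hi ?_⟩
  have : (QuotientGroup.mk (x * i y) : G ⧸ i.range) = QuotientGroup.mk x :=
    (QuotientGroup.eq.2 (by simp)).symm
  rw [hπ, this, map_mul, hπ, mul_assoc]

/-- Restricted to `K`, functions on `G` are a product of coinduced modules, one for each left coset.
The contraction inserts `π x` as first argument and evaluates at `x * (i (π x))⁻¹`, the coset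
representative, which depends only on the coset of `x`. -/
lemma acyclic_rightRegular_comp {K : Type} [Group K] (i : K →* G) (hi : Function.Injective i) :
    Acyclic ((rightRegular k G V).comp i) := by
  obtain ⟨π, hπ⟩ := exists_equivariant_retraction i hi
  intro n f hf
  refine ⟨fun g x => f (Fin.cons (π x) g) (x * (i (π x))⁻¹), funext fun g => funext fun x => ?_⟩
  have := contraction_apply ((rightRegular k G V).comp i) n f
    (fun g x => f (Fin.cons (π x) g) (x * (i (π x))⁻¹)) (π x)
    (LinearMap.proj (x * (i (π x))⁻¹)) (LinearMap.proj x)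
    (fun m => by simp [rightRegular_apply]) (fun g => rfl)
    (fun z g => by
      simp only [LinearMap.proj_apply, MonoidHom.comp_apply, rightRegular_apply, hπ, map_mul]
      congr 1
      group) g
  rw [hf] at this
  simpa using this

lemma acyclic_rightRegular : Acyclic (rightRegular k G V) :=
  acyclic_rightRegular_comp (MonoidHom.id G) Function.injective_id

end Regular

/-! ### Acyclicity for extensions by `ℤ` -/

section Extension

variable {k G M : Type} [CommRing k] [Group G] [AddCommGroup M] [Module k M]

/-- The embedding of a representation in functions on the group. -/
def orbitMap (ρ : Representation k G M) : M →ₗ[k] (G → M) where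
  toFun m g := ρ g m
  map_add' m m' := by ext; simp
  map_smul' a m := by ext; simp

lemma orbitMap_apply (ρ : Representation k G M) (m : M) (g : G) : orbitMap ρ m g = ρ g m := rfl

lemma orbitMap_equivariant (ρ : Representation k G M) (g : G) (m : M) :
    orbitMap ρ (ρ g m) = rightRegular k G M g (orbitMap ρ m) := by
  funext x
  rw [rightRegular_apply, orbitMap_apply, orbitMap_apply, map_mul]
  rfl

lemma orbitMap_injective (ρ : Representation k G M) : Function.Injective (orbitMap ρ) := by
  intro m m' h
  simpa [orbitMap_apply] using congrFun h 1

lemma coboundary_zero_apply (ρ : Representation k G M) (f : (Fin 0 → G) → M) (g : Fin 1 → G) :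
    coboundary ρ 0 f g = ρ (g 0) (f ![]) - f ![] := by
  rw [coboundary_apply]
  simp [sub_eq_add_neg, Subsingleton.elim _ (![] : Fin 0 → G)]

lemma coboundary_one_apply (ρ : Representation k G M) (f : (Fin 1 → G) → M) (g h : G) :
    coboundary ρ 1 f ![g, h] = ρ g (f ![h]) - f ![g * h] + f ![g] := by
  have h0 : (Fin.contractNth 0 (· * ·) ![g, h] : Fin 1 → G) = ![g * h] := by
    funext l; fin_cases l; simp [Fin.contractNth]
  have h1 : (Fin.contractNth 1 (· * ·) ![g, h] : Fin 1 → G) = ![g] := by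
    funext l; fin_cases l; simp [Fin.contractNth]
  have h2 : Fin.tail ![g, h] = ![h] := by
    funext l; fin_cases l; rfl
  rw [coboundary_apply, Fin.sum_univ_two, h0, h1, h2]
  simp
  abel

lemma exists_int_primitive {A : Type} [AddCommGroup A] (e : ℤ → A) :
    ∃ S : ℤ → A, ∀ n, S (n + 1) - S n = e n := by
  -- Signed summation from `0` to `n`: since `toNat` truncates at zero, at most one of the two sums
  -- is nonempty.
  refine ⟨fun n => ∑ i ∈ Finset.range n.toNat, e i -
    ∑ i ∈ Finset.range (-n).toNat, e (-(i + 1 : ℕ)), fun n => ?_⟩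
  rcases le_or_gt 0 n with h | h
  · lift n to ℕ using h
    have h1 : ((n : ℤ) + 1).toNat = n + 1 := by omega
    have h2 : (-((n : ℤ) + 1)).toNat = 0 := by omega
    have h3 : (-(n : ℤ)).toNat = 0 := by omega
    simp only [h1, h2, h3, Finset.sum_range_succ]
    simp
  · obtain ⟨m, rfl⟩ : ∃ m : ℕ, n = -(m + 1 : ℕ) := ⟨(-n - 1).toNat, by omega⟩
    have h1 : (-((m + 1 : ℕ) : ℤ) + 1).toNat = 0 := by omega
    have h2 : (-(-((m + 1 : ℕ) : ℤ) + 1)).toNat = m := by omega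
    have h3 : (-((m + 1 : ℕ) : ℤ)).toNat = 0 := by omega
    have h4 : (- -((m + 1 : ℕ) : ℤ)).toNat = m + 1 := by omega
    simp only [h1, h2, h3, h4, Finset.sum_range_succ]
    simp

variable {K : Type} [Group K]

lemma fin_one_eq {X : Type} (g : Fin 1 → X) : g = ![g 0] := by
  funext l; fin_cases l; rfl

/-- Inflation-restriction for crossed homomorphisms. After subtraction of a principal one, `ψ`
vanishes on `K`; then `ψ t` is `K`-invariant, so `hs` produces a `K`-invariant `m` whose principal
crossed homomorphism agrees with `ψ` on `K` and at `t`, which generate `G`. -/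
lemma exists_primitive_of_ker (i : K →* G) (χ : G →* Multiplicative ℤ)
    (hχ : ∀ g, χ g = 1 ↔ g ∈ i.range) (t : G) (ht : χ t = Multiplicative.ofAdd 1)
    (ρ : Representation k G M) (hK : Acyclic (ρ.comp i))
    (hs : ∀ m, (∀ y, ρ (i y) m = m) → ∃ m', (∀ y, ρ (i y) m' = m') ∧ ρ t m' - m' = m)
    (f : (Fin 1 → G) → M) (hf : coboundary ρ 1 f = 0) :
    ∃ g : (Fin 0 → G) → M, coboundary ρ 0 g = f := by
  have hmul : ∀ g h, f ![g * h] = ρ g (f ![h]) + f ![g] := fun g h => by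
    have := congrFun hf ![g, h]
    rw [coboundary_one_apply, Pi.zero_apply] at this
    rw [← sub_eq_zero, ← neg_eq_zero, ← this]
    abel
  obtain ⟨u, hu⟩ := hK 0 (fun g => f (fun j => i (g j))) (by
    refine (coboundary_naturality ρ (ρ.comp i) i LinearMap.id (fun _ _ => rfl) 1 f).trans ?_
    rw [hf]; rfl)
  have hu' : ∀ y, f ![i y] = ρ (i y) (u ![]) - u ![] := fun y => by
    have := congrFun hu ![y]
    rw [coboundary_zero_apply] at this
    rw [fin_one_eq (fun j => i (![y] j))] at this
    exact this.symm
  set ψ : G → M := fun g => f ![g] - (ρ g (u ![]) - u ![]) with hψ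
  have ψmul : ∀ g h, ψ (g * h) = ρ g (ψ h) + ψ g := fun g h => by
    simp only [hψ, hmul, map_sub, map_mul, Module.End.mul_apply]
    abel
  have ψK : ∀ y, ψ (i y) = 0 := fun y => by simp [hψ, hu']
  -- Expand `ψ` on `i y * t = t * (t⁻¹ * i y * t)` in two ways; the conjugate lies in `K` because
  -- `K` is the kernel of `χ`.
  have ψt : ∀ y, ρ (i y) (ψ t) = ψ t := fun y => by
    obtain ⟨z, hz⟩ := (hχ (t⁻¹ * i y * t)).1 (by
      simp [(hχ (i y)).2 ⟨y, rfl⟩])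
    have h1 := ψmul (i y) t
    have h2 := ψmul t (i z)
    rw [ψK, hz, show t * (t⁻¹ * i y * t) = i y * t by group, h1] at h2
    simpa [ψK] using h2
  obtain ⟨m, hm, hmt⟩ := hs _ ψt
  -- The locus where two crossed homomorphisms agree is a subgroup.
  let S : Subgroup G :=
    { carrier := {g | ψ g = ρ g m - m}
      one_mem' := by
        have := ψmul 1 1
        simp only [mul_one, map_one, Module.End.one_apply] at this
        simpa using this
      mul_mem' := fun {a b} ha hb => by
        simp only [Set.mem_ofPred_eq] at *
        rw [ψmul, ha, hb, map_sub, map_mul, Module.End.mul_apply]; abel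
      inv_mem' := fun {a} ha => by
        simp only [Set.mem_ofPred_eq] at *
        have h1 := ψmul a⁻¹ a
        have h2 : ψ 1 = 0 := by simpa using ψmul 1 1
        rw [inv_mul_cancel, h2, ha, map_sub] at h1
        have h3 : ρ a⁻¹ (ρ a m) = m := by
          rw [← Module.End.mul_apply, ← map_mul]; simp
        rw [h3] at h1
        rw [← sub_eq_zero, h1]
        abel }
  have htS : t ∈ S := hmt.symm
  have hKS : ∀ y, i y ∈ S := fun y => by
    change ψ (i y) = ρ (i y) m - m
    rw [ψK, hm, sub_self]
  have hall : ∀ g, g ∈ S := fun g => by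
    obtain ⟨y, hy⟩ := (hχ (t ^ (-(χ g).toAdd) * g)).1 (by
      rw [map_mul, map_zpow, ht, ← ofAdd_zsmul]
      simp)
    have : g = t ^ (χ g).toAdd * i y := by rw [hy]; group
    rw [this]
    exact S.mul_mem (S.zpow_mem htS _) (hKS y)
  refine ⟨fun _ => u ![] + m, funext fun g => ?_⟩
  have hg : f ![g 0] - (ρ (g 0) (u ![]) - u ![]) = ρ (g 0) m - m := hall (g 0)
  rw [coboundary_zero_apply, fin_one_eq g, map_add]
  rw [sub_eq_iff_eq_add] at hg
  simp only [Matrix.cons_val_zero]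
  rw [hg]
  abel

/-- Let `1 → K → G → ℤ → 1` be exact and let `t ∈ G` lift `1 ∈ ℤ`. A `G`-module `M` that is acyclic
for `K` and on whose `K`-invariants `t - 1` is surjective is acyclic for `G`. -/
theorem acyclic_of_ker (i : K →* G) (hi : Function.Injective i) (χ : G →* Multiplicative ℤ)
    (hχ : ∀ g, χ g = 1 ↔ g ∈ i.range) (t : G) (ht : χ t = Multiplicative.ofAdd 1)
    (ρ : Representation k G M) (hK : Acyclic (ρ.comp i))
    (hs : ∀ m, (∀ y, ρ (i y) m = m) → ∃ m', (∀ y, ρ (i y) m' = m') ∧ ρ t m' - m' = m) :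
    Acyclic ρ := by
  intro n
  induction n generalizing M with
  | zero => exact exists_primitive_of_ker i χ hχ t ht ρ hK hs
  | succ n ih =>
    intro f hf
    -- Dimension shifting: `M` embeds by its orbit maps in `I`, which is acyclic for both `G` and
    -- `K`. The quotient `σ` is shown to inherit both hypotheses, so the induction hypothesis
    -- applies to it one degree lower.
    let I := rightRegular k G M
    let W : Submodule k (G → M) := LinearMap.range (orbitMap ρ)
    have hW : ∀ g, W ≤ W.comap (I g) := by
      rintro g _ ⟨m, rfl⟩
      exact ⟨ρ g m, orbitMap_equivariant ρ g m⟩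
    let σ : Representation k G ((G → M) ⧸ W) := I.quotient W hW
    have hq : ∀ g m, W.mkQ (I g m) = σ g (W.mkQ m) := fun g m => rfl
    have hlift : ∀ {X : Type} (v : X → (G → M) ⧸ W), ∃ w : X → (G → M), ∀ x, W.mkQ (w x) = v x :=
      fun v => ⟨fun x => (W.mkQ_surjective (v x)).choose, fun x => (W.mkQ_surjective (v x)).choose_spec⟩
    have hker : ∀ {X : Type} (v : X → (G → M)), (∀ x, W.mkQ (v x) = 0) →
        ∃ w : X → M, ∀ x, orbitMap ρ (w x) = v x := fun v hv => by
      have : ∀ x, ∃ w, orbitMap ρ w = v x := fun x => (Submodule.Quotient.mk_eq_zero W).1 (hv x)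
      exact ⟨fun x => (this x).choose, fun x => (this x).choose_spec⟩
    have hIK : Acyclic (I.comp i) := acyclic_rightRegular_comp i hi
    -- The long exact sequence by elements: a lift of a cocycle of the quotient has coboundary in
    -- `M`; correcting it by a primitive `b` there yields a cocycle in `I`, which is a coboundary.
    have hσK : Acyclic (σ.comp i) := by
      intro l v hv
      obtain ⟨w, hw⟩ := hlift v
      have hw' : (fun x => W.mkQ (w x)) = v := funext hw
      obtain ⟨a, ha⟩ := hker (coboundary (I.comp i) (l + 1) w) fun x => by
        have := coboundary_map (ρ := I.comp i) (ρ' := σ.comp i) W.mkQ (fun g m => rfl) w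
        rw [hw', hv] at this
        exact (congrFun this x).symm
      have ha' : (fun x => orbitMap ρ (a x)) = coboundary (I.comp i) (l + 1) w := funext ha
      have hmap := fun (l : ℕ) (a : (Fin l → K) → M) => coboundary_map (ρ := ρ.comp i)
        (ρ' := I.comp i) (orbitMap ρ) (fun g m => orbitMap_equivariant ρ (i g) m) a
      obtain ⟨b, hb⟩ := hK (l + 1) a (by
        have := hmap _ a
        rw [ha', coboundary_coboundary] at this
        funext x
        apply orbitMap_injective ρ
        rw [← congrFun this x, Pi.zero_apply, Pi.zero_apply, map_zero])
      obtain ⟨c, hc⟩ := hIK l (w - fun x => orbitMap ρ (b x)) (by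
        rw [map_sub, hmap, hb, ha', sub_self])
      refine ⟨fun x => W.mkQ (c x), ?_⟩
      rw [coboundary_map (ρ := I.comp i) (ρ' := σ.comp i) W.mkQ (fun g m => rfl) c, hc, ← hw']
      funext x
      rw [Pi.sub_apply, map_sub, sub_eq_self]
      exact (Submodule.Quotient.mk_eq_zero W).2 ⟨_, rfl⟩
    -- As `H¹(K, M)` vanishes, a `K`-invariant class has a `K`-invariant representative `E`. It is a
    -- function of `χ` alone, so `t - 1` can be inverted by summation along `ℤ`.
    have hσs : ∀ m, (∀ y, σ (i y) m = m) → ∃ m', (∀ y, σ (i y) m' = m') ∧ σ t m' - m' = m := by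
      intro q hqK
      obtain ⟨F, rfl⟩ := W.mkQ_surjective q
      obtain ⟨a, ha⟩ := hker (coboundary (I.comp i) 0 (fun _ => F)) fun x => by
        rw [coboundary_zero_apply, map_sub, sub_eq_zero]
        exact hqK (x 0)
      have ha' : (fun x => orbitMap ρ (a x)) = coboundary (I.comp i) 0 (fun _ => F) := funext ha
      have hmap := fun (l : ℕ) (a : (Fin l → K) → M) => coboundary_map (ρ := ρ.comp i)
        (ρ' := I.comp i) (orbitMap ρ) (fun g m => orbitMap_equivariant ρ (i g) m) a
      obtain ⟨b, hb⟩ := hK 0 a (by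
        have := hmap _ a
        rw [ha', coboundary_coboundary] at this
        funext x
        apply orbitMap_injective ρ
        rw [← congrFun this x, Pi.zero_apply, Pi.zero_apply, map_zero])
      let E : G → M := F - orbitMap ρ (b ![])
      have hE : ∀ y x, E (x * i y) = E x := fun y x => by
        have h1 := ha ![y]
        rw [coboundary_zero_apply, ← congrFun hb, coboundary_zero_apply, map_sub] at h1
        have h2 := congrFun h1 x
        have h3 := congrFun (orbitMap_equivariant ρ (i y) (b ![])) x
        simp only [Pi.sub_apply, Matrix.cons_val_zero, MonoidHom.comp_apply] at h2
        rw [h3] at h2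
        simp only [I, rightRegular_apply] at h2
        simp only [E, Pi.sub_apply]
        rw [sub_eq_sub_iff_sub_eq_sub, ← h2]
      have hEt : ∀ x x', χ x = χ x' → E x = E x' := fun x x' hxx => by
        obtain ⟨y, hy⟩ := (hχ (x⁻¹ * x')).1 (by rw [map_mul, map_inv, hxx, inv_mul_cancel])
        rw [← hE y x, hy, mul_inv_cancel_left]
      obtain ⟨S, hS⟩ := exists_int_primitive (fun n => E (t ^ n))
      have hEF : W.mkQ E = W.mkQ F := by
        rw [map_sub, sub_eq_self]
        exact (Submodule.Quotient.mk_eq_zero W).2 ⟨_, rfl⟩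
      refine ⟨W.mkQ (fun x => S (χ x).toAdd), fun y => ?_, ?_⟩
      · rw [← hq]
        congr 1
        funext x
        rw [rightRegular_apply, map_mul, (hχ (i y)).2 ⟨y, rfl⟩, mul_one]
      · rw [← hq, ← map_sub, ← hEF]
        congr 1
        funext x
        rw [Pi.sub_apply, rightRegular_apply, map_mul, ht, toAdd_mul, toAdd_ofAdd, hS]
        exact hEt _ _ (by rw [map_zpow, ht, ← ofAdd_zsmul]; simp)
    -- The connecting map: `f` acquires a primitive `u` in `I`, which is a cocycle modulo `M`.
    -- Subtracting the coboundary of a lift of its primitive leaves a cochain in `M` with the same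
    -- coboundary `f`.
    obtain ⟨u, hu⟩ := acyclic_rightRegular (k := k) (G := G) (V := M) (n + 1)
      (fun g => orbitMap ρ (f g)) (by
        rw [coboundary_map (ρ := ρ) (orbitMap ρ) (orbitMap_equivariant ρ), hf]
        funext; simp)
    obtain ⟨w, hw⟩ := ih σ hσK hσs (fun g => W.mkQ (u g)) (by
      rw [coboundary_map (ρ := I) W.mkQ hq, hu]
      funext x
      exact (Submodule.Quotient.mk_eq_zero W).2 ⟨_, rfl⟩)
    obtain ⟨w', hw'⟩ := hlift w
    obtain ⟨m, hm⟩ := hker (u - coboundary I n w') fun x => by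
      rw [Pi.sub_apply, map_sub, ← congrFun (coboundary_map (ρ := I) W.mkQ hq w') x,
        funext hw', hw, sub_self]
    refine ⟨m, funext fun x => orbitMap_injective ρ ?_⟩
    rw [← congrFun (coboundary_map (ρ := ρ) (orbitMap ρ) (orbitMap_equivariant ρ) m) x, funext hm,
      map_sub, coboundary_coboundary, sub_zero, hu]

end Extension

/-! ### Subgroups of `p`-power index and locally constant cochains -/

/-- `U` is normal and its index is a power of `p`. -/
def IsPPowerIndex (p : ℕ) {G : Type} [Group G] (U : Subgroup G) : Prop :=
  U.Normal ∧ ∃ k : ℕ, U.index = p ^ k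

/-- `f` factors through a quotient of `G` of `p`-power order. -/
def IsLC (p : ℕ) {G X : Type} [Group G] {n : ℕ} (f : (Fin n → G) → X) : Prop :=
  ∃ U : Subgroup G, IsPPowerIndex p U ∧
    ∀ g g' : Fin n → G, (∀ i, (g i)⁻¹ * g' i ∈ U) → f g = f g'

/-- Every element is fixed by a subgroup of `p`-power index. -/
def IsSmooth (p : ℕ) {k G M : Type} [CommRing k] [Group G] [AddCommGroup M] [Module k M]
    (ρ : Representation k G M) : Prop :=
  ∀ m, ∃ U : Subgroup G, IsPPowerIndex p U ∧ ∀ u ∈ U, ρ u m = m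

section LocallyConstant

variable {p : ℕ} {G : Type} [Group G]

lemma isPPowerIndex_top : IsPPowerIndex p (⊤ : Subgroup G) :=
  ⟨inferInstance, 0, by simp⟩

lemma IsPPowerIndex.inf [hp : Fact p.Prime] {U W : Subgroup G} (hU : IsPPowerIndex p U)
    (hW : IsPPowerIndex p W) : IsPPowerIndex p (U ⊓ W) := by
  obtain ⟨hUn, a, ha⟩ := hU
  obtain ⟨hWn, b, hb⟩ := hW
  refine ⟨inferInstance, ?_⟩
  have h1 : (U ⊓ W).index = (U ⊓ W).relIndex W * W.index :=
    (Subgroup.relIndex_mul_index inf_le_right).symm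
  rw [Subgroup.inf_relIndex_right] at h1
  have h2 : U.relIndex W ∣ p ^ a := ha ▸ Subgroup.relIndex_dvd_index_of_normal U W
  obtain ⟨c, -, hc⟩ := (Nat.dvd_prime_pow hp.out).1 h2
  exact ⟨c + b, by rw [h1, hc, hb, pow_add]⟩

lemma IsPPowerIndex.comap {H : Type} [Group H] [hp : Fact p.Prime] (φ : H →* G) {U : Subgroup G}
    (hU : IsPPowerIndex p U) : IsPPowerIndex p (U.comap φ) := by
  obtain ⟨hUn, a, ha⟩ := hU
  refine ⟨inferInstance, ?_⟩
  have h2 : U.relIndex φ.range ∣ p ^ a := ha ▸ Subgroup.relIndex_dvd_index_of_normal U φ.range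
  obtain ⟨c, -, hc⟩ := (Nat.dvd_prime_pow hp.out).1 h2
  exact ⟨c, by rw [Subgroup.index_comap, hc]⟩

lemma IsPPowerIndex.finite [hp : Fact p.Prime] {U : Subgroup G} (hU : IsPPowerIndex p U) :
    Finite (G ⧸ U) := by
  obtain ⟨-, a, ha⟩ := hU
  have : U.FiniteIndex := ⟨by rw [ha]; exact pow_ne_zero _ hp.out.ne_zero⟩
  infer_instance

lemma isPPowerIndex_ker_of_card [hp : Fact p.Prime] {P : Type} [Group P] (φ : G →* P) {a : ℕ}
    (h : Nat.card P = p ^ a) : IsPPowerIndex p φ.ker := by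
  have : IsPPowerIndex p (⊥ : Subgroup P) := ⟨inferInstance, a, by rw [Subgroup.index_bot, h]⟩
  exact this.comap φ

variable {X Y : Type} {n : ℕ}

lemma IsLC.comp {f : (Fin n → G) → X} (hf : IsLC p f) (φ : X → Y) : IsLC p (fun g => φ (f g)) := by
  obtain ⟨U, hU, h⟩ := hf
  exact ⟨U, hU, fun g g' hg => congrArg φ (h g g' hg)⟩

lemma isLC_of_zero (f : (Fin 0 → G) → X) : IsLC p f :=
  ⟨⊤, isPPowerIndex_top, fun g g' _ => congrArg f (Subsingleton.elim g g')⟩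

lemma IsLC.map₂ [Fact p.Prime] {Z : Type} {f : (Fin n → G) → X} {f' : (Fin n → G) → Y}
    (hf : IsLC p f) (hf' : IsLC p f') (φ : X → Y → Z) : IsLC p (fun g => φ (f g) (f' g)) := by
  obtain ⟨U, hU, h⟩ := hf
  obtain ⟨W, hW, h'⟩ := hf'
  exact ⟨U ⊓ W, hU.inf hW, fun g g' hg => by
    simp only [h g g' fun i => (hg i).1, h' g g' fun i => (hg i).2]⟩

lemma IsLC.finite_range [Fact p.Prime] {f : (Fin n → G) → X} (hf : IsLC p f) :
    (Set.range f).Finite := by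
  obtain ⟨U, hU, h⟩ := hf
  have := hU.finite
  refine (Set.finite_range (fun q : Fin n → G ⧸ U => f (fun i => (q i).out))).subset ?_
  rintro _ ⟨g, rfl⟩
  exact ⟨fun i => QuotientGroup.mk (g i), h _ _ fun i =>
    QuotientGroup.eq.1 (QuotientGroup.out_eq' _)⟩

lemma contractNth_mem {U : Subgroup G} (hU : U.Normal) {g g' : Fin (n + 1) → G}
    (h : ∀ i, (g i)⁻¹ * g' i ∈ U) (j : Fin (n + 1)) (i : Fin n) :
    (Fin.contractNth j (· * ·) g i)⁻¹ * Fin.contractNth j (· * ·) g' i ∈ U := by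
  have h' : (fun i => (QuotientGroup.mk' U) (g i)) = fun i => (QuotientGroup.mk' U) (g' i) :=
    funext fun i => QuotientGroup.eq.2 (h i)
  refine (QuotientGroup.eq (s := U)).1 ?_
  have hc := fun a => congrFun (Fin.comp_contractNth (· * ·) (· * ·)
    (fun a b => map_mul (QuotientGroup.mk' U) a b) j a) i
  refine ((hc g).trans ?_).trans (hc g').symm
  exact congrArg (fun a => Fin.contractNth j (· * ·) a i) h'

variable {k M : Type} [CommRing k] [AddCommGroup M] [Module k M]

lemma IsSmooth.exists_fix_finite [Fact p.Prime] {ρ : Representation k G M} (hρ : IsSmooth p ρ)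
    {S : Set M} (hS : S.Finite) :
    ∃ U : Subgroup G, IsPPowerIndex p U ∧ ∀ u ∈ U, ∀ m ∈ S, ρ u m = m := by
  induction S, hS using Set.Finite.induction_on with
  | empty => exact ⟨⊤, isPPowerIndex_top, by simp⟩
  | @insert a S _ _ ih =>
    obtain ⟨U, hU, h⟩ := ih
    obtain ⟨W, hW, h'⟩ := hρ a
    refine ⟨U ⊓ W, hU.inf hW, fun u hu m hm => ?_⟩
    rcases hm with rfl | hm
    · exact h' u hu.2
    · exact h u hu.1 m hm

/-- Only the leading term `ρ (g 0)` needs smoothness: `f` has finitely many values, so one subgroup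
of `p`-power index fixes them all. -/
lemma IsLC.coboundary [Fact p.Prime] {ρ : Representation k G M} (hρ : IsSmooth p ρ)
    {f : (Fin n → G) → M} (hf : IsLC p f) : IsLC p (coboundary ρ n f) := by
  obtain ⟨W, hW, hfix⟩ := hρ.exists_fix_finite hf.finite_range
  obtain ⟨U, hU, h⟩ := hf
  refine ⟨U ⊓ W, hU.inf hW, fun g g' hg => ?_⟩
  rw [coboundary_apply, coboundary_apply]
  congr 1
  · rw [← h (Fin.tail g) (Fin.tail g') fun i => (hg i.succ).1]
    conv_rhs => rw [← mul_inv_cancel_left (g 0) (g' 0), map_mul, Module.End.mul_apply,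
      hfix _ (hg 0).2 _ ⟨_, rfl⟩]
  · refine Finset.sum_congr rfl fun j _ => ?_
    rw [h _ _ (contractNth_mem hU.1 (fun i => (hg i).1) j)]

end LocallyConstant

/-! ### Locally constant functions -/

section LocallyConstantFunctions

variable (p : ℕ) [hp : Fact p.Prime] (G V : Type) [Group G] [AddCommGroup V] [Module (ZMod p) V]

/-- The functions on `G` factoring through a quotient of `p`-power order. -/
def lcFun : Submodule (ZMod p) (G → V) where
  carrier := {F | ∃ U : Subgroup G, IsPPowerIndex p U ∧ ∀ x, ∀ u ∈ U, F (x * u) = F x}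
  zero_mem' := ⟨⊤, isPPowerIndex_top, fun _ _ _ => rfl⟩
  add_mem' := by
    rintro F F' ⟨U, hU, h⟩ ⟨W, hW, h'⟩
    exact ⟨U ⊓ W, hU.inf hW, fun x u hu => by
      rw [Pi.add_apply, Pi.add_apply, h x u hu.1, h' x u hu.2]⟩
  smul_mem' := by
    rintro a F ⟨U, hU, h⟩
    exact ⟨U, hU, fun x u hu => by rw [Pi.smul_apply, Pi.smul_apply, h x u hu]⟩

/-- Right translation on locally constant functions. -/
def lcRep : Representation (ZMod p) G (lcFun p G V) :=
  (rightRegular (ZMod p) G V).subrepresentation (lcFun p G V) (by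
    rintro g F ⟨U, hU, h⟩
    refine ⟨U, hU, fun x u hu => ?_⟩
    rw [rightRegular_apply, rightRegular_apply, ← h (x * g) (g⁻¹ * u * g)
      (by simpa using hU.1.conj_mem u hu g⁻¹)]
    congr 1
    group)

variable {p G V}

lemma lcRep_apply (g : G) (F : lcFun p G V) (x : G) : (lcRep p G V g F).1 x = F.1 (x * g) := rfl

lemma isSmooth_lcRep : IsSmooth p (lcRep p G V) := by
  rintro ⟨F, U, hU, h⟩
  exact ⟨U, hU, fun u hu => Subtype.ext (funext fun x => h x u hu)⟩

/-- The contraction of the regular representation preserves local constancy: the subgroup `U` that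
works for `f` works for `u`, both in the cochain variables and in the variable `x`. No acyclicity
assumption on `G` enters. -/
lemma exists_isLC_primitive {n : ℕ} {f : (Fin (n + 1) → G) → lcFun p G V} (hf : IsLC p f)
    (hd : coboundary (lcRep p G V) (n + 1) f = 0) :
    ∃ u : (Fin n → G) → lcFun p G V, IsLC p u ∧ coboundary (lcRep p G V) n u = f := by
  obtain ⟨U, hU, h⟩ := hf
  have hcons : ∀ (x x' : G) (g g' : Fin n → G), x⁻¹ * x' ∈ U → (∀ i, (g i)⁻¹ * g' i ∈ U) →
      f (Fin.cons x g) = f (Fin.cons x' g') := fun x x' g g' hx hg =>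
    h _ _ (Fin.cases hx hg)
  let ev (x : G) : lcFun p G V →ₗ[ZMod p] V := LinearMap.proj x ∘ₗ Submodule.subtype _
  let u : (Fin n → G) → lcFun p G V := fun g =>
    ⟨fun x => (f (Fin.cons x g)).1 1, U, hU, fun x y hy => by
      simp only [hcons (x * y) x g g (by simpa using hy) (fun i => by simp [U.one_mem])]⟩
  refine ⟨u, ⟨U, hU, fun g g' hg => Subtype.ext (funext fun x => ?_)⟩, funext fun g => ?_⟩
  · exact congrArg (fun F => F.1 1) (hcons x x g g' (by simp [U.one_mem]) hg)
  · refine Subtype.ext (funext fun x => ?_)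
    have := contraction_apply (lcRep p G V) n f u x (ev 1) (ev x)
      (fun m => by simp [ev, lcRep_apply]) (fun g => rfl) (fun z g => rfl) g
    rw [hd] at this
    simpa [ev] using this

/-- Coboundaries in degree `n`; in degree zero only the zero cochain. -/
def IsCoboundary {k G M : Type} [CommRing k] [Group G] [AddCommGroup M] [Module k M]
    (ρ : Representation k G M) : (n : ℕ) → ((Fin n → G) → M) → Prop
  | 0, f => f = 0
  | n + 1, f => ∃ g, coboundary ρ n g = f

lemma IsCoboundary.coboundary_eq_zero {k G M : Type} [CommRing k] [Group G] [AddCommGroup M]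
    [Module k M] {ρ : Representation k G M} {n : ℕ} {f : (Fin n → G) → M}
    (hf : IsCoboundary ρ n f) : coboundary ρ n f = 0 := by
  cases n with
  | zero => rw [show f = 0 from hf, map_zero]
  | succ n =>
    obtain ⟨g, rfl⟩ := hf
    exact coboundary_coboundary ρ n g

lemma IsCoboundary.exists_lift {k G M N : Type} [CommRing k] [Group G] [AddCommGroup M]
    [Module k M] [AddCommGroup N] [Module k N] {ρ : Representation k G M}
    {σ : Representation k G N} (L : M →ₗ[k] N) (hL : ∀ g m, L (ρ g m) = σ g (L m))
    (hsurj : Function.Surjective L) {n : ℕ} {f : (Fin n → G) → N} (hf : IsCoboundary σ n f) :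
    ∃ f', IsCoboundary ρ n f' ∧ (fun g => L (f' g)) = f := by
  cases n with
  | zero =>
    refine ⟨0, rfl, ?_⟩
    rw [show f = 0 from hf]
    funext g
    simp
  | succ n =>
    obtain ⟨g, rfl⟩ := hf
    choose s hs using hsurj
    refine ⟨coboundary ρ n (fun x => s (g x)), ⟨_, rfl⟩, ?_⟩
    rw [← coboundary_map L hL]
    simp [hs]

/-- If locally constant functions on `G` are acyclic, then a cochain with locally constant
coboundary differs from a locally constant cochain by a coboundary. -/
theorem exists_isLC_sub_of_acyclic
    (hG : ∀ (V : Type) [AddCommGroup V] [Module (ZMod p) V], Acyclic (lcRep p G V)) (n : ℕ)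
    {M : Type} [AddCommGroup M] [Module (ZMod p) M] (ρ : Representation (ZMod p) G M)
    (hρ : IsSmooth p ρ) (f : (Fin n → G) → M) (hf : IsLC p (coboundary ρ n f)) :
    ∃ b, IsCoboundary ρ n b ∧ IsLC p (f - b) := by
  induction n generalizing M with
  | zero => exact ⟨0, rfl, isLC_of_zero _⟩
  | succ n ih =>
    let I := lcRep p G M
    -- Smoothness says exactly that orbit maps are locally constant, so dimension shifting can take
    -- place inside locally constant functions.
    let ι : M →ₗ[ZMod p] lcFun p G M := (orbitMap ρ).codRestrict _ (fun m => by
      obtain ⟨U, hU, h⟩ := hρ m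
      exact ⟨U, hU, fun x u hu => by
        rw [orbitMap_apply, orbitMap_apply, map_mul, Module.End.mul_apply, h u hu]⟩)
    have hι : ∀ g m, ι (ρ g m) = I g (ι m) := fun g m =>
      Subtype.ext (orbitMap_equivariant ρ g m)
    have hιinj : Function.Injective ι := fun a b h =>
      orbitMap_injective ρ (congrArg Subtype.val h)
    let W : Submodule (ZMod p) (lcFun p G M) := LinearMap.range ι
    let σ : Representation (ZMod p) G (lcFun p G M ⧸ W) := I.quotient W (by
      rintro g _ ⟨m, rfl⟩
      exact ⟨ρ g m, hι g m⟩)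
    have hq : ∀ g m, W.mkQ (I g m) = σ g (W.mkQ m) := fun g m => rfl
    have hσ : IsSmooth p σ := fun m => by
      obtain ⟨F, rfl⟩ := W.mkQ_surjective m
      obtain ⟨U, hU, h⟩ := isSmooth_lcRep F
      exact ⟨U, hU, fun u hu => by rw [← hq, h u hu]⟩
    have hqι : ∀ m, W.mkQ (ι m) = 0 := fun m => (Submodule.Quotient.mk_eq_zero W).2 ⟨_, rfl⟩
    have hιf := coboundary_map (ρ := ρ) ι hι f
    obtain ⟨u, hu, hdu⟩ := exists_isLC_primitive (f := coboundary I (n + 1) (fun g => ι (f g)))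
      (by rw [hιf]; exact hf.comp ι) (coboundary_coboundary _ _ _)
    obtain ⟨v, hv⟩ := hG M n ((fun g => ι (f g)) - u) (by rw [map_sub, hdu, sub_self])
    have hqv := coboundary_map (ρ := I) W.mkQ hq v
    -- Modulo `M` the coboundary of `v` is `-u`, which is locally constant, so the induction
    -- hypothesis splits the class of `v`.
    obtain ⟨w', hw', hl⟩ := ih σ hσ (fun g => W.mkQ (v g)) (by
      rw [hqv, hv]
      have : (fun g => W.mkQ (((fun g => ι (f g)) - u) g)) = fun g => -W.mkQ (u g) := by
        funext g
        rw [Pi.sub_apply, map_sub, hqι, zero_sub]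
      rw [this]
      exact hu.comp (fun a => -W.mkQ a))
    obtain ⟨w, hw, rfl⟩ := hw'.exists_lift (ρ := I) W.mkQ hq W.mkQ_surjective
    choose s hs using W.mkQ_surjective
    -- Composing with a set-theoretic section keeps the lift locally constant. Then `v - l - w`
    -- comes from a cochain `m` in `M`, and `f - d m` becomes `u + d l` in `lcFun`.
    let l : (Fin n → G) → lcFun p G M := fun g => s (W.mkQ (v g) - W.mkQ (w g))
    have hlLC : IsLC p l := hl.comp s
    have hker : ∀ g, ∃ m, ι m = v g - l g - w g := fun g => by
      refine (Submodule.Quotient.mk_eq_zero W).1 ?_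
      change W.mkQ _ = 0
      rw [map_sub, map_sub, hs]
      abel
    choose m hm using hker
    have hιm := coboundary_map (ρ := ρ) ι hι m
    refine ⟨coboundary ρ n m, ⟨m, rfl⟩, ?_⟩
    have hfin : (fun g => ι ((f - coboundary ρ n m) g)) = u + coboundary I n l := by
      funext g
      rw [Pi.sub_apply, map_sub, ← congrFun hιm g,
        show (fun g => ι (m g)) = v - l - w from funext hm, map_sub, map_sub, hv,
        hw.coboundary_eq_zero]
      simp only [Pi.sub_apply, Pi.add_apply, Pi.zero_apply]
      abel
    obtain ⟨U, hU, h⟩ : IsLC p (u + coboundary I n l) :=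
      hu.map₂ (hlLC.coboundary isSmooth_lcRep) (· + ·)
    exact ⟨U, hU, fun g g' hg => hιinj (by
      have := h g g' hg
      rwa [← hfin] at this)⟩

lemma isSmooth_trivial {M : Type} [AddCommGroup M] [Module (ZMod p) M] :
    IsSmooth p (Representation.trivial (ZMod p) G M) :=
  fun _ => ⟨⊤, isPPowerIndex_top, fun _ _ => rfl⟩

end LocallyConstantFunctions

/-! ### Homology of complexes of modules, elementwise -/

section Homology

variable {R : Type} [CommRing R] {C D : CochainComplex (ModuleCat.{0} R) ℕ}

lemma exists_cycle (n : ℕ) (y : C.X n) (hy : C.d n (n + 1) y = 0) :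
    ∃ x : C.cycles n, C.iCycles n x = y :=
  (ShortComplex.moduleCat_exact_iff _).1
    (ShortComplex.exact_of_f_is_kernel (.mk (C.iCycles n) (C.d n (n + 1)) (by simp))
      (C.cyclesIsKernel n (n + 1) (by simp))) y hy

lemma d_iCycles_apply (n : ℕ) (x : C.cycles n) : C.d n (n + 1) (C.iCycles n x) = 0 := by
  rw [← ModuleCat.comp_apply, C.iCycles_d]
  rfl

lemma iCycles_injective (n : ℕ) : Function.Injective (C.iCycles n) :=
  (ModuleCat.mono_iff_injective _).1 inferInstance

lemma homologyπ_surjective (n : ℕ) : Function.Surjective (C.homologyπ n) :=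
  (ModuleCat.epi_iff_surjective _).1 inferInstance

lemma homologyπ_eq_zero_iff (i n : ℕ) (hi : (ComplexShape.up ℕ).prev n = i) (x : C.cycles n) :
    C.homologyπ n x = 0 ↔ ∃ y, C.d i n y = C.iCycles n x := by
  have hex := (ShortComplex.moduleCat_exact_iff _).1
    (ShortComplex.exact_of_g_is_cokernel
      (.mk (C.toCycles i n) (C.homologyπ n) (by simp))
      (C.homologyIsCokernel i n hi))
  constructor
  · intro h
    obtain ⟨y, hy⟩ := hex x h
    refine ⟨y, ?_⟩
    rw [← hy, ← ModuleCat.comp_apply]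
    simp
  · rintro ⟨y, hy⟩
    have : C.toCycles i n y = x := by
      apply iCycles_injective
      rw [← hy, ← ModuleCat.comp_apply]
      simp
    rw [← this, ← ModuleCat.comp_apply]
    simp

lemma hom_comm_apply (φ : C ⟶ D) (i j : ℕ) (x : C.X i) : φ.f j (C.d i j x) = D.d i j (φ.f i x) := by
  rw [← ModuleCat.comp_apply, ← ModuleCat.comp_apply, φ.comm]

lemma d_d_apply (i j l : ℕ) (x : C.X i) : C.d j l (C.d i j x) = 0 := by
  rw [← ModuleCat.comp_apply, C.d_comp_d]
  rfl

/-- An injective map of complexes is bijective on homology if every element whose differential is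
in the image is congruent to an element of the image modulo boundaries. -/
lemma homologyMap_bijective (φ : C ⟶ D) (hφ : ∀ n, Function.Injective (φ.f n))
    (h : ∀ n, ∀ y : D.X n, (∃ x, φ.f (n + 1) x = D.d n (n + 1) y) →
      ∃ i x z, (ComplexShape.up ℕ).prev n = i ∧ φ.f n x = y - D.d i n z) (n : ℕ) :
    Function.Bijective (HomologicalComplex.homologyMap φ n).hom := by
  have hπ : ∀ x, HomologicalComplex.homologyMap φ n (C.homologyπ n x) =
      D.homologyπ n (HomologicalComplex.cyclesMap φ n x) := fun x => by
    rw [← ModuleCat.comp_apply, ← ModuleCat.comp_apply, HomologicalComplex.homologyπ_naturality]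
  have hi : ∀ x, D.iCycles n (HomologicalComplex.cyclesMap φ n x) = φ.f n (C.iCycles n x) :=
    fun x => by
    rw [← ModuleCat.comp_apply, ← ModuleCat.comp_apply, HomologicalComplex.cyclesMap_i]
  constructor
  · refine (injective_iff_map_eq_zero _).2 fun a ha => ?_
    obtain ⟨x, rfl⟩ := homologyπ_surjective n a
    have ha' := (hπ x).symm.trans ha
    cases n with
    | zero =>
      -- By convention `prev 0 = 0`, and the differential from degree `0` to itself vanishes, so the
      -- only boundary in degree zero is `0`.
      rw [homologyπ_eq_zero_iff 0 0 (by simp)] at ha' ⊢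
      obtain ⟨y, hy⟩ := ha'
      rw [hi] at hy
      have h0 : C.iCycles 0 x = 0 := hφ 0 (by
        rw [← hy, D.shape _ _ (by simp), map_zero]
        rfl)
      exact ⟨0, by rw [h0, map_zero]⟩
    | succ n =>
      rw [homologyπ_eq_zero_iff n (n + 1) (by simp)] at ha' ⊢
      obtain ⟨y, hy⟩ := ha'
      rw [hi] at hy
      -- Here `h` is applied to the primitive `y`: up to a boundary it comes from some `e`, and
      -- injectivity of `φ` carries the equation back to `C`.
      obtain ⟨_, e, z, -, he⟩ := h n y ⟨_, hy.symm⟩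
      refine ⟨e, hφ _ ?_⟩
      rw [hom_comm_apply, he, map_sub, d_d_apply, sub_zero, hy]
  · intro b
    obtain ⟨y, rfl⟩ := homologyπ_surjective n b
    obtain ⟨i, x, z, hin, hx⟩ := h n (D.iCycles n y) ⟨0, by rw [d_iCycles_apply, map_zero]⟩
    obtain ⟨x', hx'⟩ := exists_cycle n x (hφ _ (by
      rw [hom_comm_apply, hx, map_sub, d_iCycles_apply, d_d_apply, map_zero, sub_zero]))
    refine ⟨C.homologyπ n x', (hπ x').trans ?_⟩
    rw [← sub_eq_zero, ← map_sub, homologyπ_eq_zero_iff i n hin]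
    refine ⟨-z, ?_⟩
    rw [map_sub, hi, hx', hx, map_neg]
    abel

lemma homology_subsingleton (n : ℕ)
    (h : ∀ y : C.X (n + 1), C.d (n + 1) (n + 2) y = 0 → ∃ z, C.d n (n + 1) z = y) :
    Subsingleton (C.homology (n + 1)) := by
  refine subsingleton_of_forall_eq 0 fun a => ?_
  obtain ⟨x, rfl⟩ := homologyπ_surjective (n + 1) a
  rw [homologyπ_eq_zero_iff n (n + 1) (by simp)]
  exact h _ (d_iCycles_apply (n + 1) x)

lemma homology_nontrivial (n : ℕ) (y : C.X (n + 1)) (hy : C.d (n + 1) (n + 2) y = 0)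
    (h : ∀ z, C.d n (n + 1) z ≠ y) : Nontrivial (C.homology (n + 1)) := by
  obtain ⟨x, rfl⟩ := exists_cycle (n + 1) y hy
  refine ⟨C.homologyπ (n + 1) x, 0, fun h0 => ?_⟩
  rw [homologyπ_eq_zero_iff n (n + 1) (by simp)] at h0
  obtain ⟨z, hz⟩ := h0
  exact h z hz

end Homology

/-! ### Continuous cochains of the pro-`p` completion -/

lemma PPowerIndexNormalSubgroup.isPPowerIndex {p : ℕ} {G : Type} [Group G]
    (N : PPowerIndexNormalSubgroup p G) : IsPPowerIndex p N.1.toSubgroup := ⟨N.1.isNormal', N.2⟩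

section Completion

variable {p : ℕ} [hp : Fact p.Prime] {G : Type} [Group G]

/-- A subgroup of `p`-power index as an index of the inverse system of quotients. -/
def IsPPowerIndex.toIndex {U : Subgroup G} (hU : IsPPowerIndex p U) :
    PPowerIndexNormalSubgroup p G :=
  ⟨{ toSubgroup := U
     isNormal' := hU.1
     isFiniteIndex' := ⟨by
      obtain ⟨k, hk⟩ := hU.2
      rw [hk]
      exact pow_ne_zero _ hp.out.ne_zero⟩ }, hU.2⟩

/-- The projection of the pro-`p` completion to a quotient of `p`-power order. -/
def completionProj {U : Subgroup G} (hU : IsPPowerIndex p U) (x : ProPCompletion p G) : G ⧸ U :=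
  x.val hU.toIndex

lemma completionProj_toProPCompletion {U : Subgroup G} (hU : IsPPowerIndex p U) (g : G) :
    completionProj hU (toProPCompletion p G g) = QuotientGroup.mk g := rfl

lemma completionProj_mul {U : Subgroup G} (hU : IsPPowerIndex p U) [U.Normal]
    (x y : ProPCompletion p G) :
    completionProj hU (x * y) = completionProj hU x * completionProj hU y := rfl

lemma completionProj_inv {U : Subgroup G} (hU : IsPPowerIndex p U) [U.Normal]
    (x : ProPCompletion p G) :
    completionProj hU x⁻¹ = (completionProj hU x)⁻¹ := rfl

lemma completionProj_eq_mk_of_le {U W : Subgroup G} (hU : IsPPowerIndex p U)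
    (hW : IsPPowerIndex p W) (h : U ≤ W) {x : ProPCompletion p G} {g : G}
    (hx : completionProj hU x = QuotientGroup.mk g) : completionProj hW x = QuotientGroup.mk g := by
  have h1 := x.2 (homOfLE (show hU.toIndex ≤ hW.toIndex from h))
  exact h1.symm.trans (congrArg (fun y : (pFiniteQuotientDiagram p G).obj hU.toIndex =>
    (pFiniteQuotientDiagram p G).map (homOfLE (show hU.toIndex ≤ hW.toIndex from h)) y) hx)

lemma completionProj_eq_of_le {U W : Subgroup G} (hU : IsPPowerIndex p U)
    (hW : IsPPowerIndex p W) (h : U ≤ W) {x y : ProPCompletion p G}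
    (hxy : completionProj hU x = completionProj hU y) :
    completionProj hW x = completionProj hW y := by
  obtain ⟨g, hg⟩ := QuotientGroup.mk_surjective (completionProj hU y)
  rw [completionProj_eq_mk_of_le hU hW h hg.symm,
    completionProj_eq_mk_of_le hU hW h (hxy.trans hg.symm)]

lemma completionProj_ext {x y : ProPCompletion p G}
    (h : ∀ (U : Subgroup G) (hU : IsPPowerIndex p U), completionProj hU x = completionProj hU y) :
    x = y :=
  Subtype.ext (funext fun N => h _ N.isPPowerIndex)

lemma isClosed_completionProj_eq {U : Subgroup G} (hU : IsPPowerIndex p U) :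
    IsClosed {q : ProPCompletion p G × ProPCompletion p G |
      completionProj hU q.1 = completionProj hU q.2} := by
  have hc : Continuous fun x : ProPCompletion p G => x.val hU.toIndex :=
    (continuous_apply hU.toIndex).comp continuous_subtype_val
  change IsClosed {q : ProPCompletion p G × ProPCompletion p G |
    q.1.val hU.toIndex = q.2.val hU.toIndex}
  exact isClosed_eq (hc.comp continuous_fst) (hc.comp continuous_snd)

lemma isOpen_completionProj_preimage {U : Subgroup G} (hU : IsPPowerIndex p U) (s : Set (G ⧸ U)) :
    IsOpen (completionProj hU ⁻¹' s) := by
  have hc : Continuous fun x : ProPCompletion p G => x.val hU.toIndex :=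
    (continuous_apply hU.toIndex).comp continuous_subtype_val
  have : DiscreteTopology ((pFiniteQuotientDiagram p G).obj hU.toIndex) := ⟨rfl⟩
  exact (isOpen_discrete (α := (pFiniteQuotientDiagram p G).obj hU.toIndex) s).preimage hc

lemma continuous_of_completionProj {X : Type} [TopologicalSpace X] {U : Subgroup G}
    (hU : IsPPowerIndex p U) {φ : ProPCompletion p G → X}
    (h : ∀ x y, completionProj hU x = completionProj hU y → φ x = φ y) : Continuous φ := by
  refine ⟨fun s _ => ?_⟩
  have : φ ⁻¹' s = completionProj hU ⁻¹' (completionProj hU '' (φ ⁻¹' s)) := by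
    refine (Set.subset_preimage_image _ _).antisymm ?_
    rintro x ⟨y, hy, hxy⟩
    rw [Set.mem_preimage, ← h y x hxy]
    exact hy
  rw [this]
  exact isOpen_completionProj_preimage hU _

/-- A continuous map from the pro-`p` completion to a discrete space factors through a quotient of
`p`-power order. -/
lemma exists_factor_of_continuous {X : Type} [TopologicalSpace X] [DiscreteTopology X]
    {φ : ProPCompletion p G → X} (hφ : Continuous φ) :
    ∃ (U : Subgroup G) (hU : IsPPowerIndex p U),
      ∀ x y, completionProj hU x = completionProj hU y → φ x = φ y := by
  -- Compactness: the pairs agreeing modulo `U` but separated by `φ` form a directed family of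
  -- nonempty closed sets. A common pair would agree in every quotient, hence be equal, and still be
  -- separated.
  by_contra! hcon
  let K : {U : Subgroup G // IsPPowerIndex p U} → Set (ProPCompletion p G × ProPCompletion p G) :=
    fun U => {q | completionProj U.2 q.1 = completionProj U.2 q.2} ∩ {q | φ q.1 ≠ φ q.2}
  have hKc : ∀ U, IsClosed (K U) := fun U => (isClosed_completionProj_eq U.2).inter
    ((isClosed_discrete {q : X × X | q.1 ≠ q.2}).preimage
      ((hφ.comp continuous_fst).prodMk (hφ.comp continuous_snd)))
  have : Nonempty {U : Subgroup G // IsPPowerIndex p U} := ⟨⟨⊤, isPPowerIndex_top⟩⟩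
  obtain ⟨q, hq⟩ := IsCompact.nonempty_iInter_of_directed_nonempty_isCompact_isClosed K
    (fun U W => ⟨⟨U.1 ⊓ W.1, U.2.inf W.2⟩,
      fun q hq => ⟨completionProj_eq_of_le _ _ inf_le_left hq.1, hq.2⟩,
      fun q hq => ⟨completionProj_eq_of_le _ _ inf_le_right hq.1, hq.2⟩⟩)
    (fun U => by
      obtain ⟨x, y, h1, h2⟩ := hcon U.1 U.2
      exact ⟨(x, y), h1, h2⟩)
    (fun U => (hKc U).isCompact) hKc
  rw [Set.mem_iInter] at hq
  exact (hq ⟨⊤, isPPowerIndex_top⟩).2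
    (congrArg φ (completionProj_ext fun U hU => (hq ⟨U, hU⟩).1))

end Completion

/-! ### Iterated continuous functions -/

section Iterated

variable {p : ℕ} {Γ : Type} [Group Γ] [TopologicalSpace Γ] [IsTopologicalGroup Γ]

lemma evalTuple_injective : ∀ (n : ℕ) (F F' : TopRep.resolutionX (trivialTopRep p Γ) n),
    (∀ x, evalTuple n F x = evalTuple n F' x) → F = F'
  | 0, _, _, h => h ![]
  | n + 1, F, F', h => by
    refine ContinuousMap.ext (f := (F : C(Γ, TopRep.resolutionX (trivialTopRep p Γ) n)))
      (g := (F' : C(Γ, TopRep.resolutionX (trivialTopRep p Γ) n))) fun y => ?_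
    exact evalTuple_injective n _ _ fun x => h (Fin.cons y x)

/-- A continuous `f` has finite range and compact fibres, so finitely many compact-open conditions,
one for each fibre, isolate it. -/
lemma discreteTopology_continuousMap (X Y : Type) [TopologicalSpace X] [TopologicalSpace Y]
    [CompactSpace X] [DiscreteTopology Y] : DiscreteTopology C(X, Y) := by
  refine discreteTopology_iff_isOpen_singleton.2 fun f => ?_
  have hfin : (Set.range f).Finite := (isCompact_range f.continuous).finite_of_discrete
  have : {f} = ⋂ y ∈ Set.range f, {g : C(X, Y) | Set.MapsTo g (f ⁻¹' {y}) {y}} := by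
    ext g
    simp only [Set.mem_singleton_iff, Set.mem_iInter, Set.mem_ofPred_eq]
    constructor
    · rintro rfl y - x hx
      exact hx
    · intro h
      ext x
      exact h (f x) ⟨x, rfl⟩ rfl
  rw [this]
  exact hfin.isOpen_biInter fun y _ => ContinuousMap.isOpen_setOfPred_mapsTo
    ((isClosed_discrete {y}).preimage f.continuous).isCompact (isOpen_discrete {y})

lemma discreteTopology_resolutionX [CompactSpace Γ] :
    ∀ n : ℕ, DiscreteTopology (TopRep.resolutionX (trivialTopRep p Γ) n)
  | 0 => inferInstanceAs (DiscreteTopology (ZMod p))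
  | n + 1 =>
    have : DiscreteTopology (TopRep.resolutionX (trivialTopRep p Γ) n) :=
      discreteTopology_resolutionX n
    discreteTopology_continuousMap Γ (TopRep.resolutionX (trivialTopRep p Γ) n)

end Iterated

/-! ### Continuous cochains of the completion as locally constant cochains of the group -/

section CompletionCochains

variable {p : ℕ} [hp : Fact p.Prime] {G : Type} [Group G]

/-- By compactness and discreteness the curried function has finitely many values; each factors
through a finite quotient by induction, and finitely many subgroups can be intersected. -/
lemma exists_factor_evalTuple : ∀ (n : ℕ)
    (F : TopRep.resolutionX (trivialTopRep p (ProPCompletion p G)) n),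
    ∃ (U : Subgroup G) (hU : IsPPowerIndex p U), ∀ x y : Fin n → ProPCompletion p G,
      (∀ i, completionProj hU (x i) = completionProj hU (y i)) → evalTuple n F x = evalTuple n F y
  | 0, _ => ⟨⊤, isPPowerIndex_top, fun _ _ _ => rfl⟩
  | n + 1, F => by
    let F' : C(ProPCompletion p G, TopRep.resolutionX (trivialTopRep p (ProPCompletion p G)) n) := F
    have := discreteTopology_resolutionX (p := p) (Γ := ProPCompletion p G) n
    obtain ⟨U, hU, h⟩ := exists_factor_of_continuous F'.continuous
    have hfin : (Set.range F').Finite := (isCompact_range F'.continuous).finite_of_discrete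
    have key : ∀ S : Set (TopRep.resolutionX (trivialTopRep p (ProPCompletion p G)) n), S.Finite →
        ∃ (W : Subgroup G) (hW : IsPPowerIndex p W), ∀ E ∈ S, ∀ x y : Fin n → ProPCompletion p G,
        (∀ i, completionProj hW (x i) = completionProj hW (y i)) →
          evalTuple n E x = evalTuple n E y := by
      intro S hS
      induction S, hS using Set.Finite.induction_on with
      | empty => exact ⟨⊤, isPPowerIndex_top, by simp⟩
      | @insert E S _ _ ih =>
        obtain ⟨W, hW, h⟩ := ih
        obtain ⟨W', hW', h'⟩ := exists_factor_evalTuple n E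
        refine ⟨W ⊓ W', hW.inf hW', fun E' hE' x y hxy => ?_⟩
        rcases hE' with rfl | hE'
        · exact h' x y fun i => completionProj_eq_of_le _ hW' inf_le_right (hxy i)
        · exact h E' hE' x y fun i => completionProj_eq_of_le _ hW inf_le_left (hxy i)
    obtain ⟨W, hW, h'⟩ := key _ hfin
    refine ⟨U ⊓ W, hU.inf hW, fun x y hxy => ?_⟩
    have h0 : F' (x 0) = F' (y 0) := h _ _ (completionProj_eq_of_le _ hU inf_le_left (hxy 0))
    change evalTuple n (F' (x 0)) (Fin.tail x) = evalTuple n (F' (y 0)) (Fin.tail y)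
    rw [h0]
    exact h' _ ⟨_, rfl⟩ _ _ fun i => completionProj_eq_of_le _ hW inf_le_right (hxy i.succ)

lemma exists_evalTuple_eq {U : Subgroup G} (hU : IsPPowerIndex p U) : ∀ (n : ℕ)
    (φ : (Fin n → ProPCompletion p G) → ZMod p), (∀ x y, (∀ i, completionProj hU (x i) =
      completionProj hU (y i)) → φ x = φ y) →
    ∃ F : TopRep.resolutionX (trivialTopRep p (ProPCompletion p G)) n, ∀ x, evalTuple n F x = φ x
  | 0, φ, _ => ⟨(φ ![] : ZMod p), fun x => congrArg φ (Subsingleton.elim _ _)⟩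
  | n + 1, φ, h => by
    have h' : ∀ y, ∃ F : TopRep.resolutionX (trivialTopRep p (ProPCompletion p G)) n,
        ∀ x, evalTuple n F x = φ (Fin.cons y x) := fun y =>
      exists_evalTuple_eq hU n (fun x => φ (Fin.cons y x)) fun x x' hx =>
        h _ _ (Fin.cases rfl hx)
    choose F hF using h'
    let F' : C(ProPCompletion p G, TopRep.resolutionX (trivialTopRep p (ProPCompletion p G)) n) :=
      ⟨F, continuous_of_completionProj hU fun y y' hy => evalTuple_injective n _ _ fun x => by
        rw [hF, hF]
        exact h _ _ (Fin.cases hy fun i => rfl)⟩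
    refine ⟨F', fun x => ?_⟩
    change evalTuple n (F (x 0)) (Fin.tail x) = _
    rw [hF, Fin.cons_self_tail]

lemma partialProd_congr {U : Subgroup G} (hU : U.Normal) {n : ℕ} {g g' : Fin n → G}
    (h : ∀ i, (g i)⁻¹ * g' i ∈ U) (i : Fin (n + 1)) :
    (QuotientGroup.mk (Fin.partialProd g i) : G ⧸ U) = QuotientGroup.mk (Fin.partialProd g' i) := by
  induction i using Fin.induction with
  | zero => simp
  | succ i ih =>
    rw [Fin.partialProd_succ, Fin.partialProd_succ, QuotientGroup.mk_mul, QuotientGroup.mk_mul, ih,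
      QuotientGroup.eq.2 (h i)]

lemma isLC_pullbackCochain (n : ℕ) (σ : (contCochains p (ProPCompletion p G)).X n) :
    IsLC p (pullbackCochain (toProPCompletion p G) n σ) := by
  obtain ⟨U, hU, h⟩ := exists_factor_evalTuple (n + 1) σ.1
  exact ⟨U, hU, fun g g' hg => h (fun i => toProPCompletion p G (Fin.partialProd g i))
    (fun i => toProPCompletion p G (Fin.partialProd g' i)) fun i => partialProd_congr hU.1 hg i⟩

/-- Density: modulo the subgroup through which `σ` factors, every tuple comes from `G`. Invariance
then moves its first entry to `1`, which gives a tuple of partial products. -/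
lemma pullbackCochain_injective (n : ℕ) :
    Function.Injective (pullbackCochain (p := p) (toProPCompletion p G) n) := by
  refine (injective_iff_map_eq_zero _).2 fun σ hσ => ?_
  obtain ⟨U, hU, h⟩ := exists_factor_evalTuple (n + 1) σ.1
  refine Subtype.ext (evalTuple_injective (n + 1) _ _ fun x => ?_)
  have hx : ∀ i, ∃ g : G, (QuotientGroup.mk g : G ⧸ U) = completionProj hU (x i) :=
    fun i => QuotientGroup.mk_surjective _
  choose g hg using hx
  have h1 : evalTuple (n + 1) σ.1 x = evalTuple (n + 1) σ.1 (fun i => toProPCompletion p G (g i)) :=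
    h _ _ fun i => (hg i).symm
  have h2 := evalTuple_rho (n + 1) (toProPCompletion p G (g 0)) σ.1
    (fun i => toProPCompletion p G (g i))
  have h3 := congrFun hσ (fun i => (g i.castSucc)⁻¹ * g i.succ)
  have h4 : (fun i => (toProPCompletion p G (g 0))⁻¹ * toProPCompletion p G (g i)) =
      fun i => toProPCompletion p G
        (Fin.partialProd (fun i => (g i.castSucc)⁻¹ * g i.succ) i) := by
    funext i
    have := congrFun (Fin.partialProd_left_inv g) i
    rw [Pi.smul_apply, smul_eq_mul] at this
    rw [← map_inv, ← map_mul]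
    conv_lhs => rw [← this]
    rw [inv_mul_cancel_left]
  have h5 : evalTuple (n + 1) (0 : TopRep.resolutionX (trivialTopRep p (ProPCompletion p G)) (n + 1))
      x = 0 := by
    have := evalTuple_smul (n + 1) 0
      (0 : TopRep.resolutionX (trivialTopRep p (ProPCompletion p G)) (n + 1)) x
    simpa using this
  rw [h1]
  refine Eq.trans ?_ h5.symm
  refine (congrArg (fun F => evalTuple (n + 1) F _) (σ.2 (toProPCompletion p G (g 0)))).symm.trans ?_
  refine h2.trans ?_
  rw [h4]
  exact h3

/-- The homogeneous cochain is `f` evaluated on representatives of the successive quotients `xᵢ⁻¹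
xᵢ₊₁`, which are invariant under left translation. -/
lemma exists_pullbackCochain_eq (n : ℕ) {f : (Fin n → G) → ZMod p} (hf : IsLC p f) :
    ∃ σ : (contCochains p (ProPCompletion p G)).X n,
      pullbackCochain (toProPCompletion p G) n σ = f := by
  obtain ⟨U, hU, h⟩ := hf
  have := hU.1
  let φ : (Fin (n + 1) → ProPCompletion p G) → ZMod p := fun x =>
    f fun i => (completionProj hU ((x i.castSucc)⁻¹ * x i.succ)).out
  obtain ⟨F, hF⟩ := exists_evalTuple_eq hU (n + 1) φ fun x y hxy => by
    refine congrArg f (funext fun i => congrArg Quotient.out ?_)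
    refine (completionProj_mul hU _ _).trans (Eq.trans ?_ (completionProj_mul hU _ _).symm)
    rw [completionProj_inv, completionProj_inv, hxy, hxy]
  refine ⟨⟨F, fun x => evalTuple_injective (n + 1) _ _ fun y => ?_⟩, ?_⟩
  · rw [hF]
    refine (evalTuple_rho (n + 1) x F y).trans ?_
    rw [hF]
    simp only [φ]
    congr 1
    funext i
    congr 2
    group
  · funext g
    refine (hF fun i => toProPCompletion p G (Fin.partialProd g i)).trans (h _ g fun i => ?_)
    rw [← map_inv, ← map_mul, Fin.partialProd_right_inv, completionProj_toProPCompletion]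
    exact QuotientGroup.eq.1 (QuotientGroup.out_eq' _)

/-- If locally constant functions on `G` are acyclic for every prime, then `G` lies in `𝒞`. -/
theorem isInClassC_of_acyclic (hG : ∀ p : ℕ, [Fact p.Prime] → ∀ (V : Type) [AddCommGroup V]
    [Module (ZMod p) V], Acyclic (lcRep p G V)) : IsInClassC G := by
  intro p hp n
  have : Fact p.Prime := ⟨hp⟩
  refine Function.Bijective.comp (g := (HomologicalComplex.homologyMap
    (pullbackCochains (toProPCompletion p G)) n).hom) ?_
    (((contCochains p (ProPCompletion p G)).sc n).mapHomologyIso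
      (forget₂ (TopModuleCat (ZMod p)) (ModuleCat (ZMod p)))).symm.toLinearEquiv.bijective
  refine homologyMap_bijective _ (fun n => pullbackCochain_injective n) ?_ n
  rintro n y ⟨x, hx⟩
  rw [groupCohomology.inhomogeneousCochains.d_def] at hx
  have hy : IsLC p (coboundary (Representation.trivial (ZMod p) G (ZMod p)) n y) := by
    have := isLC_pullbackCochain (n + 1) x
    rwa [show pullbackCochain (toProPCompletion p G) (n + 1) x = coboundary _ n y from hx] at this
  -- The image of the pull-back is the locally constant cochains, so this splitting is what the
  -- criterion `homologyMap_bijective` asks for.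
  obtain ⟨b, hb, hyb⟩ := exists_isLC_sub_of_acyclic (hG p) n _ isSmooth_trivial y hy
  obtain ⟨σ, hσ⟩ := exists_pullbackCochain_eq n hyb
  cases n with
  | zero =>
    refine ⟨0, σ, 0, by simp, ?_⟩
    rw [map_zero, sub_zero]
    rw [show b = 0 from hb, sub_zero] at hσ
    exact hσ
  | succ n =>
    obtain ⟨z, rfl⟩ := hb
    refine ⟨n, σ, z, by simp, ?_⟩
    rw [groupCohomology.inhomogeneousCochains.d_def]
    exact hσ

lemma contH_succ_subsingleton (n : ℕ)
    (h : ∀ f : (Fin (n + 1) → G) → ZMod p, IsLC p f →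
      coboundary (Representation.trivial (ZMod p) G (ZMod p)) (n + 1) f = 0 →
      ∃ b, IsLC p b ∧ coboundary (Representation.trivial (ZMod p) G (ZMod p)) n b = f) :
    Subsingleton (ContH p (ProPCompletion p G) (n + 1)) := by
  have e := ((contCochains p (ProPCompletion p G)).sc (n + 1)).mapHomologyIso
    (forget₂ (TopModuleCat (ZMod p)) (ModuleCat (ZMod p)))
  have hs := homology_subsingleton (C := ((forget₂ (TopModuleCat (ZMod p))
    (ModuleCat (ZMod p))).mapHomologicalComplex _).obj (contCochains p (ProPCompletion p G))) n
    (fun y hy => by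
      obtain ⟨b, hb, hbf⟩ := h (pullbackCochain (toProPCompletion p G) (n + 1) y)
        (isLC_pullbackCochain (n + 1) y) (by
          refine (pullbackCochain_d (toProPCompletion p G) (n + 1) y).symm.trans ?_
          exact (congrArg (pullbackCochain (toProPCompletion p G) (n + 2)) hy).trans (map_zero _))
      obtain ⟨σ, hσ⟩ := exists_pullbackCochain_eq n hb
      refine ⟨σ, pullbackCochain_injective (n + 1) ?_⟩
      refine (pullbackCochain_d (toProPCompletion p G) n σ).trans ?_
      rw [← hbf, ← hσ]
      rfl)
  exact e.symm.toLinearEquiv.toEquiv.subsingleton (β := (((forget₂ (TopModuleCat (ZMod p))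
    (ModuleCat (ZMod p))).mapHomologicalComplex _).obj
      (contCochains p (ProPCompletion p G))).homology (n + 1))

end CompletionCochains

/-! ### The Heisenberg group -/

/-- The Heisenberg group over a ring. -/
@[ext]
structure Heis (R : Type) where
  /-- the first coordinate -/
  u : R
  /-- the second coordinate -/
  v : R
  /-- the central coordinate -/
  w : R

namespace Heis

section Group

variable {R : Type} [CommRing R]

instance : Mul (Heis R) := ⟨fun x y => ⟨x.u + y.u, x.v + y.v, x.w + y.w + x.u * y.v⟩⟩
instance : One (Heis R) := ⟨⟨0, 0, 0⟩⟩
instance : Inv (Heis R) := ⟨fun x => ⟨-x.u, -x.v, -x.w + x.u * x.v⟩⟩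

@[simp] lemma mul_u (x y : Heis R) : (x * y).u = x.u + y.u := rfl
@[simp] lemma mul_v (x y : Heis R) : (x * y).v = x.v + y.v := rfl
@[simp] lemma mul_w (x y : Heis R) : (x * y).w = x.w + y.w + x.u * y.v := rfl
@[simp] lemma one_u : (1 : Heis R).u = 0 := rfl
@[simp] lemma one_v : (1 : Heis R).v = 0 := rfl
@[simp] lemma one_w : (1 : Heis R).w = 0 := rfl
@[simp] lemma inv_u (x : Heis R) : x⁻¹.u = -x.u := rfl
@[simp] lemma inv_v (x : Heis R) : x⁻¹.v = -x.v := rfl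
@[simp] lemma inv_w (x : Heis R) : x⁻¹.w = -x.w + x.u * x.v := rfl

instance : Group (Heis R) := Group.ofLeftAxioms
  (fun x y z => by ext <;> simp <;> ring)
  (fun x => by ext <;> simp)
  (fun x => by ext <;> simp)

/-- Functoriality of the Heisenberg group. -/
def map {S : Type} [CommRing S] (f : R →+* S) : Heis R →* Heis S where
  toFun x := ⟨f x.u, f x.v, f x.w⟩
  map_one' := by ext <;> simp
  map_mul' x y := by ext <;> simp

lemma card_zmod (n : ℕ) [NeZero n] : Nat.card (Heis (ZMod n)) = n ^ 3 := by
  have e : Heis (ZMod n) ≃ ZMod n × ZMod n × ZMod n :=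
    { toFun := fun x => (x.u, x.v, x.w)
      invFun := fun x => ⟨x.1, x.2.1, x.2.2⟩
      left_inv := fun x => rfl
      right_inv := fun x => rfl }
  rw [Nat.card_congr e, Nat.card_prod, Nat.card_prod, Nat.card_zmod]
  ring

/-- In general the last coordinate also contains `n(n-1)/2` times `x.u * x.v`; only elements without
that term are needed. -/
lemma pow_eq (x : Heis R) (n : ℕ) :
    (x ^ n).u = n * x.u ∧ (x ^ n).v = n * x.v ∧ (x.u * x.v = 0 → (x ^ n).w = n * x.w) := by
  induction n with
  | zero => simp
  | succ n ih =>
    obtain ⟨h1, h2, h3⟩ := ih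
    rw [pow_succ]
    refine ⟨?_, ?_, fun h => ?_⟩
    · simp [h1]; ring
    · simp [h2]; ring
    · simp only [mul_w, h3 h, h1, mul_assoc, h]; push_cast; ring

end Group

/-! ### Congruence subgroups -/

section Congruence

/-- Reduction modulo `n`. -/
abbrev reduction (n : ℕ) : Heis ℤ →* Heis (ZMod n) := map (Int.castRingHom (ZMod n))

lemma mem_ker_reduction {n : ℕ} {x : Heis ℤ} :
    x ∈ (reduction n).ker ↔ (n : ℤ) ∣ x.u ∧ (n : ℤ) ∣ x.v ∧ (n : ℤ) ∣ x.w := by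
  rw [MonoidHom.mem_ker, Heis.ext_iff]
  simp [map, ZMod.intCast_zmod_eq_zero_iff_dvd]

lemma exists_ker_reduction_le {p : ℕ} {U : Subgroup (Heis ℤ)} (hU : IsPPowerIndex p U) :
    ∃ k, (reduction (p ^ k)).ker ≤ U := by
  obtain ⟨hUn, k, hk⟩ := hU
  refine ⟨k, fun x hx => ?_⟩
  obtain ⟨⟨a, ha⟩, ⟨b, hb⟩, c, hc⟩ := mem_ker_reduction.1 hx
  -- A normal subgroup contains all powers with exponent its index. The `v`-factor stands to the
  -- left of the `u`-factor so that no cross term appears.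
  have h : x = ⟨0, b, 0⟩ ^ U.index * ⟨a, 0, 0⟩ ^ U.index * ⟨0, 0, c⟩ ^ U.index := by
    obtain ⟨h1, h2, h3⟩ := pow_eq (⟨0, b, 0⟩ : Heis ℤ) U.index
    obtain ⟨h4, h5, h6⟩ := pow_eq (⟨a, 0, 0⟩ : Heis ℤ) U.index
    obtain ⟨h7, h8, h9⟩ := pow_eq (⟨0, 0, c⟩ : Heis ℤ) U.index
    rw [hk] at *
    ext
    · simp [h1, h4, h7, ha]
    · simp [h2, h5, h8, hb]
    · simp [h1, h3, h4, h5, h6, h8, h9, hc]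
  rw [h]
  exact U.mul_mem (U.mul_mem (U.pow_index_mem _) (U.pow_index_mem _)) (U.pow_index_mem _)

variable {p : ℕ} [hp : Fact p.Prime]

lemma isPPowerIndex_ker_reduction (k : ℕ) : IsPPowerIndex p (reduction (p ^ k)).ker := by
  have : NeZero (p ^ k) := ⟨pow_ne_zero _ hp.out.ne_zero⟩
  exact isPPowerIndex_ker_of_card (a := k * 3) _ (by rw [card_zmod, pow_mul])

lemma mem_lcFun_iff {V : Type} [AddCommGroup V] [Module (ZMod p) V] {F : Heis ℤ → V} :
    F ∈ lcFun p (Heis ℤ) V ↔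
      ∃ k, ∀ x y, reduction (p ^ k) x = reduction (p ^ k) y → F x = F y := by
  constructor
  · rintro ⟨U, hU, h⟩
    obtain ⟨k, hk⟩ := exists_ker_reduction_le hU
    refine ⟨k, fun x y hxy => ?_⟩
    rw [← h x (x⁻¹ * y) (hk (by simp [MonoidHom.mem_ker, hxy])), mul_inv_cancel_left]
  · rintro ⟨k, h⟩
    exact ⟨_, isPPowerIndex_ker_reduction k, fun x y hy => h _ _ (by
      rw [map_mul, MonoidHom.mem_ker.1 hy, mul_one])⟩

lemma isResiduallyPFinite : IsResiduallyPFinite p (Heis ℤ) := by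
  intro g hg
  -- Every coordinate is bounded by `k < p ^ k`, so divisibility by `p ^ k` forces it to vanish.
  let k := g.u.natAbs + g.v.natAbs + g.w.natAbs
  refine ⟨(isPPowerIndex_ker_reduction k).toIndex, fun hmem => hg ?_⟩
  obtain ⟨h1, h2, h3⟩ := mem_ker_reduction.1 hmem
  have hlt : k < p ^ k := Nat.lt_pow_self hp.out.one_lt
  have hz : ∀ a : ℤ, ((p ^ k : ℕ) : ℤ) ∣ a → a.natAbs ≤ k → a = 0 := fun a h hle =>
    Int.eq_zero_of_dvd_of_natAbs_lt_natAbs h (by rw [Int.natAbs_natCast]; omega)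
  ext
  · exact hz _ h1 (by omega)
  · exact hz _ h2 (by omega)
  · exact hz _ h3 (by omega)

end Congruence

end Heis

/-! ### Periodic solutions of difference equations -/

section Primitive

variable {p : ℕ} {V : Type} [AddCommGroup V] [Module (ZMod p) V]

/-- A solution of the difference equation `S (n + 1) - S n = e n`. -/
noncomputable def intPrimitive (e : ℤ → V) : ℤ → V := (exists_int_primitive e).choose

lemma intPrimitive_spec (e : ℤ → V) (n : ℤ) : intPrimitive e (n + 1) - intPrimitive e n = e n :=
  (exists_int_primitive e).choose_spec n

/-- Over one period of `e` the primitive grows by a constant; over `p` periods it grows by `p` times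
that constant, which is zero in `V`. -/
lemma intPrimitive_congr {e : ℤ → V} {q : ℤ} (he : ∀ n, e (n + q) = e n) {m n : ℤ}
    (h : p * q ∣ n - m) : intPrimitive e n = intPrimitive e m := by
  have hstep : ∀ n, intPrimitive e (n + q) - intPrimitive e n =
      intPrimitive e q - intPrimitive e 0 := fun n => by
    have hs : ∀ n, intPrimitive e (n + 1 + q) - intPrimitive e (n + 1) =
        intPrimitive e (n + q) - intPrimitive e n := fun n => by
      have h1 := intPrimitive_spec e (n + q)
      have h2 := intPrimitive_spec e n
      rw [he, ← h2, show n + q + 1 = n + 1 + q by ring] at h1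
      rw [sub_eq_sub_iff_sub_eq_sub, h1]
    induction n using Int.induction_on with
    | zero => rw [zero_add]
    | succ n ih => rw [hs, ih]
    | pred n ih => rw [← ih, ← hs, sub_add_cancel]
  have hmul : ∀ (l : ℕ) n, intPrimitive e (n + l * q) =
      intPrimitive e n + l • (intPrimitive e q - intPrimitive e 0) := fun l => by
    induction l with
    | zero => simp
    | succ l ih =>
      intro n
      rw [show n + ((l + 1 : ℕ) : ℤ) * q = n + l * q + q by push_cast; ring,
        ← sub_add_cancel (intPrimitive e (n + l * q + q)) (intPrimitive e (n + l * q)), hstep, ih,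
        succ_nsmul]
      abel
  have hper : ∀ n, intPrimitive e (n + p * q) = intPrimitive e n := fun n => by
    rw [hmul, ← Nat.cast_smul_eq_nsmul (ZMod p), CharP.cast_eq_zero, zero_smul, add_zero]
  have hall : ∀ (l : ℤ) n, intPrimitive e (n + l * (p * q)) = intPrimitive e n := fun l => by
    induction l using Int.induction_on with
    | zero => simp
    | succ l ih => intro n; rw [← ih n, ← hper (n + l * (p * q))]; congr 1; ring
    | pred l ih => intro n; rw [← ih n, ← hper (n + (-l - 1) * (p * q))]; congr 1; ring
  obtain ⟨l, hl⟩ := h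
  rw [show n = m + l * (p * q) by linarith, hall]

end Primitive

/-! ### Acyclicity of locally constant functions -/

section LCAcyclic

lemma dvd_of_cast_eq {p k : ℕ} {m n : ℤ} (h : (n : ZMod (p ^ (k + 1))) = m) :
    (p : ℤ) * ((p ^ k : ℕ) : ℤ) ∣ n - m := by
  rw [← sub_eq_zero, ← Int.cast_sub, ZMod.intCast_zmod_eq_zero_iff_dvd] at h
  refine dvd_trans (dvd_of_eq ?_) h
  push_cast
  ring

lemma cast_eq_of_cast_eq {p k : ℕ} {m n : ℤ} (h : (n : ZMod (p ^ (k + 1))) = m) :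
    (n : ZMod (p ^ k)) = m := by
  have := congrArg (ZMod.castHom (pow_dvd_pow p (Nat.le_succ k)) (ZMod (p ^ k))) h
  simpa using this

variable {p : ℕ} [hp : Fact p.Prime] {V : Type} [AddCommGroup V] [Module (ZMod p) V]

variable (V) in
/-- Transport of locally constant functions along an isomorphism. -/
def lcFunCongr {G H : Type} [Group G] [Group H] (e : H ≃* G) :
    lcFun p G V ≃ₗ[ZMod p] lcFun p H V where
  toFun F := ⟨fun x => F.1 (e x), by
    obtain ⟨U, hU, h⟩ := F.2
    exact ⟨_, hU.comap e.toMonoidHom, fun x u hu => by simp only [map_mul]; exact h _ _ hu⟩⟩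
  invFun F := ⟨fun x => F.1 (e.symm x), by
    obtain ⟨U, hU, h⟩ := F.2
    exact ⟨_, hU.comap e.symm.toMonoidHom, fun x u hu => by simp only [map_mul]; exact h _ _ hu⟩⟩
  map_add' _ _ := rfl
  map_smul' _ _ := rfl
  left_inv F := Subtype.ext (funext fun x => congrArg F.1 (e.apply_symm_apply x))
  right_inv F := Subtype.ext (funext fun x => congrArg F.1 (e.symm_apply_apply x))

lemma acyclic_lcRep_of_mulEquiv {G H : Type} [Group G] [Group H] (e : H ≃* G)
    (hG : Acyclic (lcRep p G V)) : Acyclic (lcRep p H V) :=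
  Acyclic.of_equiv (ρ := lcRep p G V) e (lcFunCongr V e) (fun h F => Subtype.ext (funext fun x =>
    congrArg F.1 (map_mul e x h).symm)) hG

lemma periodic_of_mem_lcFun_int {F : Multiplicative ℤ → V}
    (hF : F ∈ lcFun p (Multiplicative ℤ) V) :
    ∃ k : ℕ, ∀ n : ℤ, F (Multiplicative.ofAdd (n + (p ^ k : ℕ))) = F (Multiplicative.ofAdd n) := by
  obtain ⟨U, ⟨hUn, k, hk⟩, h⟩ := hF
  refine ⟨k, fun n => ?_⟩
  rw [ofAdd_add, h]
  have := U.pow_index_mem (Multiplicative.ofAdd 1)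
  rwa [hk, ← ofAdd_nsmul, nsmul_eq_mul, mul_one] at this

lemma exact_unit (x : Multiplicative ℤ) :
    MonoidHom.id _ x = 1 ↔ x ∈ (1 : Unit →* Multiplicative ℤ).range := by
  simp

/-- With trivial kernel, `acyclic_of_ker` only asks for a locally constant solution of a difference
equation; period `p ^ k` becomes `p ^ (k + 1)`. -/
lemma acyclic_lcRep_int : Acyclic (lcRep p (Multiplicative ℤ) V) := by
  refine acyclic_of_ker (1 : Unit →* Multiplicative ℤ) (fun _ _ _ => rfl) (MonoidHom.id _)
    exact_unit (Multiplicative.ofAdd 1) rfl _ (Acyclic.of_subsingleton _) fun F _ => ?_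
  obtain ⟨k, hk⟩ := periodic_of_mem_lcFun_int F.2
  let F' : lcFun p (Multiplicative ℤ) V :=
    ⟨fun x => intPrimitive (fun n => F.1 (Multiplicative.ofAdd n)) x.toAdd, by
      have : NeZero (p ^ (k + 1)) := ⟨pow_ne_zero _ hp.out.ne_zero⟩
      refine ⟨_, isPPowerIndex_ker_of_card (p := p) (a := k + 1) (P := Multiplicative
        (ZMod (p ^ (k + 1)))) (AddMonoidHom.toMultiplicative (Int.castAddHom _))
        (by simp), fun x u hu => intPrimitive_congr (p := p) hk ?_⟩
      have hu' : ((u.toAdd : ℤ) : ZMod (p ^ (k + 1))) = 0 := hu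
      rw [ZMod.intCast_zmod_eq_zero_iff_dvd] at hu'
      rw [toAdd_mul, add_sub_cancel_left]
      refine dvd_trans (dvd_of_eq ?_) hu'
      push_cast
      ring⟩
  refine ⟨F', fun y => ?_, Subtype.ext (funext fun x => ?_)⟩
  · rw [MonoidHom.one_apply, map_one]; rfl
  · exact intPrimitive_spec (fun n => F.1 (Multiplicative.ofAdd n)) x.toAdd

lemma cast_add_self (n : ℤ) (q : ℕ) : ((n + q : ℤ) : ZMod q) = n := by
  rw [Int.cast_add, Int.cast_natCast, ZMod.natCast_self, add_zero]

namespace Heis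

/-- The inclusion of the center. -/
def centralInclusion : Multiplicative ℤ →* Multiplicative (ℤ × ℤ) :=
  AddMonoidHom.toMultiplicative (AddMonoidHom.inr ℤ ℤ)

/-- The inclusion of the abelian normal subgroup `u = 0`. -/
def abelianInclusion : Multiplicative (ℤ × ℤ) →* Heis ℤ where
  toFun x := ⟨0, x.toAdd.1, x.toAdd.2⟩
  map_one' := rfl
  map_mul' x y := by ext <;> simp

/-- The first coordinate. -/
def uHom : Heis ℤ →* Multiplicative ℤ where
  toFun x := Multiplicative.ofAdd x.u
  map_one' := rfl
  map_mul' _ _ := rfl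

lemma reduction_eq_iff {n : ℕ} {x y : Heis ℤ} : reduction n x = reduction n y ↔
    (x.u : ZMod n) = y.u ∧ (x.v : ZMod n) = y.v ∧ (x.w : ZMod n) = y.w := by
  rw [Heis.ext_iff]; rfl

/-- Climb from the trivial group through the centre and the subgroup `u = 0` to the whole group,
adjoining the directions `w`, `v`, `u`. Invariance under the previous subgroup removes the
coordinates already treated, so each stage is a difference equation in a single variable, the others
being parameters modulo `p ^ k`. -/
theorem acyclic_lcRep : Acyclic (lcRep p (Heis ℤ) V) := by
  have hc : Acyclic ((((lcRep p (Heis ℤ) V).comp abelianInclusion).comp centralInclusion)) := by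
    refine acyclic_of_ker (1 : Unit →* Multiplicative ℤ) (fun _ _ _ => rfl) (MonoidHom.id _)
      exact_unit (Multiplicative.ofAdd 1) rfl _ (Acyclic.of_subsingleton _) fun F _ => ?_
    obtain ⟨k, hk⟩ := mem_lcFun_iff.1 F.2
    let F' : lcFun p (Heis ℤ) V := ⟨fun x => intPrimitive (fun n => F.1 ⟨x.u, x.v, n⟩) x.w,
      mem_lcFun_iff.2 ⟨k + 1, fun x y hxy => by
        obtain ⟨h1, h2, h3⟩ := reduction_eq_iff.1 hxy
        have : (fun n => F.1 ⟨x.u, x.v, n⟩) = fun n => F.1 ⟨y.u, y.v, n⟩ := funext fun n =>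
          hk _ _ (reduction_eq_iff.2 ⟨cast_eq_of_cast_eq h1, cast_eq_of_cast_eq h2, rfl⟩)
        rw [this]
        exact intPrimitive_congr (p := p) (fun n => hk ⟨y.u, y.v, n + (p ^ k : ℕ)⟩ ⟨y.u, y.v, n⟩
            (reduction_eq_iff.2 ⟨rfl, rfl, cast_add_self _ _⟩))
          (dvd_of_cast_eq h3)⟩⟩
    refine ⟨F', fun y => ?_, Subtype.ext (funext fun x => ?_)⟩
    · rw [MonoidHom.one_apply, map_one]; rfl
    · refine Eq.trans ?_ (intPrimitive_spec (fun n => F.1 ⟨x.u, x.v, n⟩) x.w)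
      change intPrimitive (fun n => F.1 ⟨x.u + 0, x.v + 0, n⟩) (x.w + 1 + x.u * 0) - _ = _
      rw [add_zero, add_zero, mul_zero, add_zero]
  have ha : Acyclic ((lcRep p (Heis ℤ) V).comp abelianInclusion) := by
    refine acyclic_of_ker centralInclusion ?_
      (AddMonoidHom.toMultiplicative (AddMonoidHom.fst ℤ ℤ)) ?_
      (Multiplicative.ofAdd (1, 0)) rfl _ hc fun F hF => ?_
    · exact fun x y h => congrArg Prod.snd h
    · intro g
      constructor
      · exact fun h => ⟨Multiplicative.ofAdd g.toAdd.2, Prod.ext (Eq.symm h) rfl⟩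
      · rintro ⟨y, rfl⟩
        rfl
    have hF' : ∀ u v w, F.1 ⟨u, v, w⟩ = F.1 ⟨u, v, 0⟩ := fun u v w => by
      have := congrFun (congrArg Subtype.val (hF (Multiplicative.ofAdd w))) ⟨u, v, 0⟩
      refine Eq.trans (congrArg F.1 ?_) this
      ext <;> simp [abelianInclusion, centralInclusion]
    obtain ⟨k, hk⟩ := mem_lcFun_iff.1 F.2
    let F' : lcFun p (Heis ℤ) V := ⟨fun x => intPrimitive (fun n => F.1 ⟨x.u, n, 0⟩) x.v,
      mem_lcFun_iff.2 ⟨k + 1, fun x y hxy => by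
        obtain ⟨h1, h2, h3⟩ := reduction_eq_iff.1 hxy
        have : (fun n => F.1 ⟨x.u, n, 0⟩) = fun n => F.1 ⟨y.u, n, 0⟩ := funext fun n =>
          hk _ _ (reduction_eq_iff.2 ⟨cast_eq_of_cast_eq h1, rfl, rfl⟩)
        rw [this]
        exact intPrimitive_congr (p := p) (fun n => hk ⟨y.u, n + (p ^ k : ℕ), 0⟩ ⟨y.u, n, 0⟩
            (reduction_eq_iff.2 ⟨rfl, cast_add_self _ _, rfl⟩))
          (dvd_of_cast_eq h2)⟩⟩
    refine ⟨F', fun y => Subtype.ext (funext fun x => ?_), Subtype.ext (funext fun x => ?_)⟩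
    · change intPrimitive (fun n => F.1 ⟨x.u + 0, n, 0⟩) (x.v + 0) = _
      rw [add_zero, add_zero]
    · have := intPrimitive_spec (fun n => F.1 ⟨x.u, n, 0⟩) x.v
      refine Eq.trans ?_ (this.trans (hF' x.u x.v x.w).symm)
      change intPrimitive (fun n => F.1 ⟨x.u + 0, n, 0⟩) (x.v + 1) - _ = _
      rw [add_zero]
  refine acyclic_of_ker abelianInclusion ?_ uHom ?_ ⟨1, 0, 0⟩ rfl _ ha fun F hF => ?_
  · exact fun x y h => Prod.ext (congrArg Heis.v h) (congrArg Heis.w h)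
  · intro g
    constructor
    · exact fun h => ⟨Multiplicative.ofAdd (g.v, g.w), Heis.ext (Eq.symm h) rfl rfl⟩
    · rintro ⟨y, rfl⟩
      rfl
  have hF' : ∀ u v w, F.1 ⟨u, v, w⟩ = F.1 ⟨u, 0, 0⟩ := fun u v w => by
    -- The shift by `u * v` compensates the cross term in `⟨u, 0, 0⟩ * ⟨0, v, _⟩`.
    have := congrFun (congrArg Subtype.val (hF (Multiplicative.ofAdd (v, w - u * v)))) ⟨u, 0, 0⟩
    refine Eq.trans (congrArg F.1 ?_) this
    ext <;> simp [abelianInclusion]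
  obtain ⟨k, hk⟩ := mem_lcFun_iff.1 F.2
  let F' : lcFun p (Heis ℤ) V := ⟨fun x => intPrimitive (fun n => F.1 ⟨n, 0, 0⟩) x.u,
    mem_lcFun_iff.2 ⟨k + 1, fun x y hxy => by
      obtain ⟨h1, h2, h3⟩ := reduction_eq_iff.1 hxy
      exact intPrimitive_congr (p := p) (fun n => hk ⟨n + (p ^ k : ℕ), 0, 0⟩ ⟨n, 0, 0⟩
            (reduction_eq_iff.2 ⟨cast_add_self _ _, rfl, rfl⟩))
        (dvd_of_cast_eq h1)⟩⟩
  refine ⟨F', fun y => Subtype.ext (funext fun x => ?_), Subtype.ext (funext fun x => ?_)⟩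
  · change intPrimitive (fun n => F.1 ⟨n, 0, 0⟩) (x.u + 0) = _
    rw [add_zero]
  · have := intPrimitive_spec (fun n => F.1 ⟨n, 0, 0⟩) x.u
    exact this.trans (hF' x.u x.v x.w).symm

end Heis

end LCAcyclic

/-! ### The groups `G₁` and `G₂` -/

section ShearGroups

lemma shear_zero_zpow (j : ℤ) (x : RankTwoLattice) :
    (shear 0 ^ j) x = Multiplicative.ofAdd (x.toAdd.1 + j * x.toAdd.2, x.toAdd.2) := by
  induction j using Int.induction_on generalizing x with
  | zero => simp
  | succ j ih =>
    rw [zpow_add_one, MulAut.mul_apply, ih]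
    change Multiplicative.ofAdd (x.toAdd.1 + x.toAdd.2 + j * x.toAdd.2, x.toAdd.2) = _
    congr 2
    ring
  | pred j ih =>
    rw [zpow_sub_one, MulAut.mul_apply, ih]
    change Multiplicative.ofAdd (x.toAdd.1 - x.toAdd.2 + (-j : ℤ) * x.toAdd.2, x.toAdd.2) = _
    congr 2
    ring

lemma shear_one_zpow (j : ℤ) (x : RankTwoLattice) :
    (shear 1 ^ j) x = Multiplicative.ofAdd (x.toAdd.1, j * x.toAdd.1 + x.toAdd.2) := by
  induction j using Int.induction_on generalizing x with
  | zero => simp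
  | succ j ih =>
    rw [zpow_add_one, MulAut.mul_apply, ih]
    change Multiplicative.ofAdd (x.toAdd.1, j * x.toAdd.1 + (x.toAdd.1 + x.toAdd.2)) = _
    congr 2
    ring
  | pred j ih =>
    rw [zpow_sub_one, MulAut.mul_apply, ih]
    change Multiplicative.ofAdd (x.toAdd.1, (-j : ℤ) * x.toAdd.1 + (x.toAdd.2 - x.toAdd.1)) = _
    congr 2
    ring

/-- `G₁` is the integral Heisenberg group. -/
def shearGroupZeroEquiv : ShearGroup 0 ≃* Heis ℤ where
  toFun x := ⟨x.right.toAdd, x.left.toAdd.2, x.left.toAdd.1⟩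
  invFun x := ⟨Multiplicative.ofAdd (x.w, x.v), Multiplicative.ofAdd x.u⟩
  left_inv _ := rfl
  right_inv _ := rfl
  map_mul' x y := by
    have h : (x * y).left = x.left * (shear 0 ^ x.right.toAdd) y.left := rfl
    rw [shear_zero_zpow] at h
    ext
    · rfl
    · simp [h]
    · simp [h, add_assoc]

/-- `G₂` is the integral Heisenberg group. -/
def shearGroupOneEquiv : ShearGroup 1 ≃* Heis ℤ where
  toFun x := ⟨x.right.toAdd, x.left.toAdd.1, x.left.toAdd.2⟩
  invFun x := ⟨Multiplicative.ofAdd (x.v, x.w), Multiplicative.ofAdd x.u⟩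
  left_inv _ := rfl
  right_inv _ := rfl
  map_mul' x y := by
    have h : (x * y).left = x.left * (shear 1 ^ x.right.toAdd) y.left := rfl
    rw [shear_one_zpow] at h
    ext
    · rfl
    · simp [h]
    · simp [h]
      ring

lemma nonempty_shearGroup_mulEquiv : ∀ i : Fin 2, Nonempty (ShearGroup i ≃* Heis ℤ)
  | 0 => ⟨shearGroupZeroEquiv⟩
  | 1 => ⟨shearGroupOneEquiv⟩

/-- `G₁ / N` and `G₂ / N` are infinite cyclic. -/
noncomputable def shearGroupQuotientEquiv (i : Fin 2) :
    ShearGroup i ⧸ (latticeInclusion i).range ≃* Multiplicative ℤ :=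
  (QuotientGroup.quotientMulEquivOfEq SemidirectProduct.range_inl_eq_ker_rightHom).trans
    (QuotientGroup.quotientKerEquivOfSurjective _ SemidirectProduct.rightHom_surjective)

lemma isInClassC_shearGroup (i : Fin 2) : IsInClassC (ShearGroup i) := by
  obtain ⟨e⟩ := nonempty_shearGroup_mulEquiv i
  refine isInClassC_of_acyclic ?_
  intro p _ V _ _
  exact acyclic_lcRep_of_mulEquiv e Heis.acyclic_lcRep

lemma isInClassC_shearGroup_quotient (i : Fin 2) :
    IsInClassC (ShearGroup i ⧸ (latticeInclusion i).range) := by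
  refine isInClassC_of_acyclic ?_
  intro p _ V _ _
  exact acyclic_lcRep_of_mulEquiv (shearGroupQuotientEquiv i) acyclic_lcRep_int

lemma isResiduallyPFinite_of_mulEquiv {p : ℕ} [Fact p.Prime] {G H : Type} [Group G] [Group H]
    (e : H ≃* G) (hG : IsResiduallyPFinite p G) : IsResiduallyPFinite p H := by
  intro h hh
  obtain ⟨N, hN⟩ := hG (e h) (by simpa using hh)
  exact ⟨(N.isPPowerIndex.comap e.toMonoidHom).toIndex, hN⟩

/-! ### Torsion, generation and nilpotency class of the Heisenberg group -/

namespace Heis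

lemma not_isOfFinOrder {x : Heis ℤ} (hx : x ≠ 1) : ¬ IsOfFinOrder x := by
  intro h
  obtain ⟨n, hn, hxn⟩ := isOfFinOrder_iff_pow_eq_one.1 h
  obtain ⟨h1, h2, h3⟩ := pow_eq x n
  rw [hxn] at h1 h2 h3
  have hn' : n ≠ 0 := hn.ne'
  have hu : x.u = 0 := by simpa [hn'] using h1.symm
  have hv : x.v = 0 := by simpa [hn'] using h2.symm
  have hw : x.w = 0 := by simpa [hn'] using (h3 (by simp [hu])).symm
  exact hx (Heis.ext hu hv hw)

instance : Group.FG (Heis ℤ) := by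
  let a : Heis ℤ := ⟨1, 0, 0⟩
  let b : Heis ℤ := ⟨0, 1, 0⟩
  let c : Heis ℤ := ⟨0, 0, 1⟩
  refine Group.fg_iff.2 ⟨{a, b, c}, eq_top_iff.2 fun x _ => ?_, by simp⟩
  have hu : ∀ n : ℤ, a ^ n = ⟨n, 0, 0⟩ := fun n => by
    let f : Multiplicative ℤ →* Heis ℤ :=
      { toFun := fun n => ⟨n.toAdd, 0, 0⟩, map_one' := rfl, map_mul' := fun x y => by ext <;> simp }
    have := map_zpow f (Multiplicative.ofAdd 1) n
    rw [← ofAdd_zsmul, smul_eq_mul, mul_one] at this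
    exact this.symm
  have hvw : ∀ (m : ℤ × ℤ) (n : ℤ), abelianInclusion (Multiplicative.ofAdd m) ^ n =
      ⟨0, n * m.1, n * m.2⟩ := fun m n => by
    rw [← map_zpow, ← ofAdd_zsmul]
    rfl
  have h : x = b ^ x.v * a ^ x.u * c ^ x.w := by
    rw [hu, show b = abelianInclusion (Multiplicative.ofAdd (1, 0)) from rfl,
      show c = abelianInclusion (Multiplicative.ofAdd (0, 1)) from rfl, hvw, hvw]
    ext <;> simp
  have hmem : ∀ y ∈ ({a, b, c} : Set (Heis ℤ)), y ∈ Subgroup.closure {a, b, c} :=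
    fun y hy => Subgroup.subset_closure hy
  rw [h]
  exact mul_mem (mul_mem (zpow_mem (hmem _ (by simp)) _) (zpow_mem (hmem _ (by simp)) _))
    (zpow_mem (hmem _ (by simp)) _)

/-- The quotient by the center. -/
def centralQuotient : Heis ℤ →* Multiplicative (ℤ × ℤ) where
  toFun x := Multiplicative.ofAdd (x.u, x.v)
  map_one' := rfl
  map_mul' _ _ := rfl

lemma ker_centralQuotient_le : centralQuotient.ker ≤ Subgroup.center (Heis ℤ) := by
  intro x hx
  have hu : x.u = 0 := congrArg Prod.fst hx
  have hv : x.v = 0 := congrArg Prod.snd hx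
  rw [Subgroup.mem_center_iff]
  intro y
  ext
  · simp [hu]
  · simp [hv]
  · simp [hu, hv, add_comm]

lemma exists_nilpotencyClass_eq_two {G : Type} [Group G] (e : G ≃* Heis ℤ) :
    ∃ _ : Group.IsNilpotent G, Group.nilpotencyClass G = 2 := by
  have h1 : Group.IsNilpotent (Heis ℤ) :=
    Subgroup.isNilpotent_of_ker_le_center centralQuotient ker_centralQuotient_le
  have h2 : Group.IsNilpotent G := Group.nilpotent_of_mulEquiv e.symm
  refine ⟨h2, le_antisymm ?_ ?_⟩
  · refine (Group.nilpotencyClass_le_of_surjective e.symm.toMonoidHom e.symm.surjective).trans ?_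
    refine (Group.nilpotencyClass_le_of_ker_le_center centralQuotient ker_centralQuotient_le).trans ?_
    exact Nat.add_le_add_right CommGroup.nilpotencyClass_le_one 1
  · by_contra hlt
    have hle : Group.nilpotencyClass G ≤ 1 := by omega
    have hcomm := Group.IsNilpotent.nilpotencyClass_le_one_iff.1 hle
    have h3 := hcomm.is_comm.comm (e.symm ⟨1, 0, 0⟩) (e.symm ⟨0, 1, 0⟩)
    rw [← map_mul, ← map_mul] at h3
    have h4 := congrArg Heis.w (e.symm.injective h3)
    simp at h4

end Heis

lemma not_range_le_center : ∀ i : Fin 2,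
    ¬ (latticeInclusion i).range ≤ Subgroup.center (ShearGroup i)
  | 0, h => by
    have h1 := Subgroup.mem_center_iff.1
      (h ⟨Multiplicative.ofAdd (0, 1), rfl⟩) (SemidirectProduct.inr (Multiplicative.ofAdd 1))
    have h2 := congrArg Heis.w (congrArg shearGroupZeroEquiv h1)
    rw [map_mul, map_mul] at h2
    exact absurd h2 (by decide)
  | 1, h => by
    have h1 := Subgroup.mem_center_iff.1
      (h ⟨Multiplicative.ofAdd (1, 0), rfl⟩) (SemidirectProduct.inr (Multiplicative.ofAdd 1))
    have h2 := congrArg Heis.w (congrArg shearGroupOneEquiv h1)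
    rw [map_mul, map_mul] at h2
    exact absurd h2 (by decide)

lemma not_isCyclic_rankTwoLattice : ¬ IsCyclic RankTwoLattice := by
  rintro ⟨g, hg⟩
  obtain ⟨m, hm⟩ := Subgroup.mem_zpowers_iff.1 (hg (Multiplicative.ofAdd (1, 0)))
  obtain ⟨n, hn⟩ := Subgroup.mem_zpowers_iff.1 (hg (Multiplicative.ofAdd (0, 1)))
  have h1 : m * g.toAdd.1 = 1 := congrArg Prod.fst hm
  have h2 : m * g.toAdd.2 = 0 := congrArg Prod.snd hm
  have h4 : n * g.toAdd.2 = 1 := congrArg Prod.snd hn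
  rcases mul_eq_zero.1 h2 with h | h
  · simp [h] at h1
  · simp [h] at h4

end ShearGroups

/-! ### The amalgamated product and its finite `p`-quotients -/

namespace ShearAmalgam

/-- The stable letters. -/
def stableLetter (i : Fin 2) : ShearAmalgam :=
  Monoid.PushoutI.of (φ := latticeInclusion) i (SemidirectProduct.inr (Multiplicative.ofAdd 1))

/-- The inclusion of the amalgamated subgroup. -/
abbrev lattice : RankTwoLattice →* ShearAmalgam := Monoid.PushoutI.base latticeInclusion

lemma conj_lattice (i : Fin 2) (x : RankTwoLattice) :
    stableLetter i * lattice x * (stableLetter i)⁻¹ = lattice (shear i x) := by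
  rw [lattice, ← Monoid.PushoutI.of_apply_eq_base latticeInclusion i x,
    ← Monoid.PushoutI.of_apply_eq_base latticeInclusion i (shear i x), stableLetter,
    ← map_inv, ← map_mul, ← map_mul]
  congr 1
  have := SemidirectProduct.inl_aut (φ := zpowersHom (MulAut RankTwoLattice) (shear i))
    (Multiplicative.ofAdd 1) x
  rw [map_inv] at this
  rw [← this]
  simp

lemma hom_ext {K : Type} [Group K] {f g : ShearAmalgam →* K}
    (h : ∀ x, f (lattice x) = g (lattice x)) (hs : ∀ i, f (stableLetter i) = g (stableLetter i)) :
    f = g := by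
  refine Monoid.PushoutI.hom_ext_nonempty fun i => SemidirectProduct.hom_ext ?_ ?_
  · refine MonoidHom.ext fun x => ?_
    have := h x
    rw [lattice, ← Monoid.PushoutI.of_apply_eq_base latticeInclusion i x] at this
    exact this
  · exact MonoidHom.ext_mint (hs i)

/-- The quotient of `G` by `N`. -/
def toFree : ShearAmalgam →* FreeGroup (Fin 2) :=
  Monoid.PushoutI.lift (fun i => (zpowersHom _ (FreeGroup.of i)).comp SemidirectProduct.rightHom) 1
    (fun i => by
      ext x
      simp)

/-- The section sending free generators to stable letters. -/
def ofFree : FreeGroup (Fin 2) →* ShearAmalgam := FreeGroup.lift stableLetter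

lemma toFree_stableLetter (i : Fin 2) : toFree (stableLetter i) = FreeGroup.of i := by
  rw [toFree, stableLetter, Monoid.PushoutI.lift_of]
  simp

lemma toFree_ofFree (x : FreeGroup (Fin 2)) : toFree (ofFree x) = x := by
  have : toFree.comp ofFree = MonoidHom.id _ := by
    ext i
    simp [ofFree, toFree_stableLetter]
  exact DFunLike.congr_fun this x

lemma eq_pow_mul_pow (x : RankTwoLattice) : x =
    Multiplicative.ofAdd ((1, 0) : ℤ × ℤ) ^ x.toAdd.1 *
      Multiplicative.ofAdd ((0, 1) : ℤ × ℤ) ^ x.toAdd.2 := by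
  rw [← ofAdd_zsmul, ← ofAdd_zsmul, ← ofAdd_add]
  refine congrArg Multiplicative.ofAdd (Prod.ext ?_ ?_) <;> simp <;> rfl

/-- Each shear sends one basis vector to the sum of both, so each vector is, up to inversion, a
commutator of the other with a stable letter. Membership in the lower central series therefore
climbs simultaneously for the two; a single shear would not suffice. -/
lemma map_lattice_of_isNilpotent {P : Type} [Group P] [hP : Group.IsNilpotent P]
    (φ : ShearAmalgam →* P) (x : RankTwoLattice) : φ (lattice x) = 1 := by
  have hcomm : ∀ (i : Fin 2) (a b : RankTwoLattice), shear i a = b * a →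
      ∀ k, φ (lattice a) ∈ (⊤ : Subgroup P).lowerCentralSeries k →
        φ (lattice b) ∈ (⊤ : Subgroup P).lowerCentralSeries (k + 1) := fun i a b hab k ha => by
    have h1 : b = shear i a * a⁻¹ := by rw [hab, mul_inv_cancel_right]
    have h2 : φ (lattice b) = (φ (lattice a) * φ (stableLetter i) * (φ (lattice a))⁻¹ *
        (φ (stableLetter i))⁻¹)⁻¹ := by
      rw [h1, map_mul, ← conj_lattice]
      simp [mul_assoc]
    rw [h2]
    exact inv_mem (Subgroup.commutator_mem_commutator ha (Subgroup.mem_top _))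
  have hmem : ∀ k, φ (lattice (Multiplicative.ofAdd (1, 0))) ∈
      (⊤ : Subgroup P).lowerCentralSeries k ∧ φ (lattice (Multiplicative.ofAdd (0, 1))) ∈
      (⊤ : Subgroup P).lowerCentralSeries k := fun k => by
    induction k with
    | zero => exact ⟨Subgroup.mem_top _, Subgroup.mem_top _⟩
    | succ k ih => exact ⟨hcomm 0 _ _ rfl k ih.2, hcomm 1 _ _ rfl k ih.1⟩
  obtain ⟨n, hn⟩ := Subgroup.nilpotent_iff_lowerCentralSeries.1 hP
  have h := hmem n
  rw [hn, Subgroup.mem_bot, Subgroup.mem_bot] at h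
  rw [eq_pow_mul_pow x, map_mul, map_mul, map_zpow, map_zpow, map_zpow, map_zpow, h.1, h.2]
  simp

lemma map_ofFree_toFree {P : Type} [Group P] [Group.IsNilpotent P] (φ : ShearAmalgam →* P)
    (x : ShearAmalgam) : φ (ofFree (toFree x)) = φ x := by
  have : (φ.comp ofFree).comp toFree = φ := hom_ext
    (fun x => by simp [map_lattice_of_isNilpotent])
    (fun i => by simp [toFree_stableLetter, ofFree])
  exact DFunLike.congr_fun this x

end ShearAmalgam

/-! ### The pro-`p` completion of the amalgam -/

section Nilpotent

variable {p : ℕ} [hp : Fact p.Prime] {G : Type} [Group G]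

lemma IsPPowerIndex.isNilpotent {U : Subgroup G} (hU : IsPPowerIndex p U) [U.Normal] :
    Group.IsNilpotent (G ⧸ U) := by
  have := hU.finite
  obtain ⟨-, k, hk⟩ := hU
  exact (IsPGroup.of_card (n := k) hk).isNilpotent

/-! ### Functoriality of the pro-`p` completion -/

/-- The map of pro-`p` completions induced by a homomorphism. -/
def completionMap {H : Type} [Group H] (f : G →* H) :
    ProPCompletion p G →* ProPCompletion p H :=
  MonoidHom.mk' (fun x => ⟨fun N => QuotientGroup.map _ N.1.toSubgroup f le_rfl
      (completionProj (N.isPPowerIndex.comap f) x), fun {N M} h => by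
    obtain ⟨g, hg⟩ := QuotientGroup.mk_surjective
      (completionProj (N.isPPowerIndex.comap f) x)
    have hg' := completionProj_eq_mk_of_le _ (M.isPPowerIndex.comap f)
      (Subgroup.comap_mono (leOfHom h)) hg.symm
    exact (congrArg (fun y => (pFiniteQuotientDiagram p H).map h
      (QuotientGroup.map _ N.1.toSubgroup f le_rfl y)) hg.symm).trans
      (congrArg (QuotientGroup.map _ M.1.toSubgroup f le_rfl) hg').symm⟩)
    fun x y => Subtype.ext (funext fun N => map_mul (QuotientGroup.map _ N.1.toSubgroup f le_rfl)
    (completionProj (N.isPPowerIndex.comap f) x) (completionProj (N.isPPowerIndex.comap f) y))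

lemma completionProj_completionMap {H : Type} [Group H] (f : G →* H) {U : Subgroup H}
    (hU : IsPPowerIndex p U) {x : ProPCompletion p G} {g : G}
    (h : completionProj (hU.comap f) x = QuotientGroup.mk g) :
    completionProj hU (completionMap f x) = QuotientGroup.mk (f g) := by
  have := hU.1
  exact congrArg (QuotientGroup.map _ U f le_rfl) h

lemma continuous_completionMap {H : Type} [Group H] (f : G →* H) :
    Continuous (completionMap (p := p) f) := by
  refine continuous_induced_rng.2 (continuous_pi fun N => ?_)
  refine continuous_of_completionProj (N.isPPowerIndex.comap f) fun x y h => ?_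
  obtain ⟨g, hg⟩ := QuotientGroup.mk_surjective (completionProj (N.isPPowerIndex.comap f) y)
  exact (completionProj_completionMap f N.isPPowerIndex (h.trans hg.symm)).trans
    (completionProj_completionMap f N.isPPowerIndex hg.symm).symm

/-- The composite `f' ∘ f` need only be the identity modulo every subgroup of `p`-power index; for
the amalgam it is not the identity, since it kills `N`. -/
lemma completionMap_completionMap {H : Type} [Group H] (f : G →* H) (f' : H →* G)
    (h : ∀ (U : Subgroup G), IsPPowerIndex p U → ∀ g, g⁻¹ * f' (f g) ∈ U)
    (x : ProPCompletion p G) : completionMap f' (completionMap f x) = x := by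
  refine completionProj_ext fun U hU => ?_
  -- The intersection provides one `g` representing `x` modulo both subgroups.
  have hW := hU.inf ((hU.comap f').comap f)
  obtain ⟨g, hg⟩ := QuotientGroup.mk_surjective (completionProj hW x)
  have h1 := completionProj_eq_mk_of_le hW hU inf_le_left hg.symm
  have h2 := completionProj_eq_mk_of_le hW ((hU.comap f').comap f) inf_le_right hg.symm
  rw [completionProj_completionMap f' hU (completionProj_completionMap f (hU.comap f') h2), h1]
  exact (QuotientGroup.eq.2 (h U hU g)).symm

/-- `Ĝ^p` is the free pro-`p` group on two generators. -/
def ShearAmalgam.completionEquiv :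
    ProPCompletion p ShearAmalgam ≃ₜ* ProPCompletion p (FreeGroup (Fin 2)) where
  toFun := completionMap ShearAmalgam.toFree
  invFun := completionMap ShearAmalgam.ofFree
  left_inv := completionMap_completionMap _ _ fun U hU g => by
    have := hU.1
    have := hU.isNilpotent
    exact QuotientGroup.eq.1 (ShearAmalgam.map_ofFree_toFree (QuotientGroup.mk' U) g).symm
  right_inv := completionMap_completionMap _ _ fun U _ g => by
    rw [ShearAmalgam.toFree_ofFree, inv_mul_cancel]
    exact U.one_mem
  map_mul' := map_mul _
  continuous_toFun := continuous_completionMap _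
  continuous_invFun := continuous_completionMap _

end Nilpotent

/-! ### Extensions defined by cocycles -/

/-- The central extension of `P` by `A` defined by a 2-cocycle. -/
@[ext]
structure CocycleExtension {P A : Type} [Group P] [AddCommGroup A] (f : P → P → A)
    (hf : ∀ x y z, f y z + f x (y * z) = f (x * y) z + f x y) where
  /-- the component in the kernel -/
  a : A
  /-- the component in the quotient -/
  x : P

namespace CocycleExtension

variable {P A : Type} [Group P] [AddCommGroup A] {f : P → P → A}
  {hf : ∀ x y z, f y z + f x (y * z) = f (x * y) z + f x y}

instance : Mul (CocycleExtension f hf) := ⟨fun e e' => ⟨e.a + e'.a + f e.x e'.x, e.x * e'.x⟩⟩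
-- The cocycle is not assumed normalized, hence the correction by `f 1 1`; the left unit law then
-- uses `f 1 x = f 1 1`.
instance : One (CocycleExtension f hf) := ⟨⟨-f 1 1, 1⟩⟩
instance : Inv (CocycleExtension f hf) := ⟨fun e => ⟨-e.a - f e.x⁻¹ e.x - f 1 1, e.x⁻¹⟩⟩

lemma mul_a (e e' : CocycleExtension f hf) : (e * e').a = e.a + e'.a + f e.x e'.x := rfl
lemma mul_x (e e' : CocycleExtension f hf) : (e * e').x = e.x * e'.x := rfl
lemma one_a : (1 : CocycleExtension f hf).a = -f 1 1 := rfl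
lemma one_x : (1 : CocycleExtension f hf).x = 1 := rfl
lemma inv_a (e : CocycleExtension f hf) : e⁻¹.a = -e.a - f e.x⁻¹ e.x - f 1 1 := rfl
lemma inv_x (e : CocycleExtension f hf) : e⁻¹.x = e.x⁻¹ := rfl

instance : Group (CocycleExtension f hf) := Group.ofLeftAxioms
  (fun e e' e'' => by
    ext
    · have := hf e.x e'.x e''.x
      simp only [mul_a, mul_x]
      have h : e.a + (e'.a + e''.a + f e'.x e''.x) + f e.x (e'.x * e''.x) =
        e.a + e'.a + e''.a + (f e'.x e''.x + f e.x (e'.x * e''.x)) := by abel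
      rw [h, this]
      abel
    · exact mul_assoc _ _ _)
  (fun e => by
    ext
    · have := hf 1 1 e.x
      rw [one_mul, one_mul, add_right_inj] at this
      rw [mul_a, one_a, one_x, this]
      abel
    · exact one_mul _)
  (fun e => by
    ext
    · rw [mul_a, inv_a, inv_x, one_a]
      abel
    · exact inv_mul_cancel _)

/-- The projection to the quotient. -/
def proj : CocycleExtension f hf →* P where
  toFun e := e.x
  map_one' := rfl
  map_mul' _ _ := rfl

lemma card : Nat.card (CocycleExtension f hf) = Nat.card A * Nat.card P := by
  have e : CocycleExtension f hf ≃ A × P :=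
    { toFun := fun e => (e.a, e.x)
      invFun := fun e => ⟨e.1, e.2⟩
      left_inv := fun _ => rfl
      right_inv := fun _ => rfl }
  rw [Nat.card_congr e, Nat.card_prod]

end CocycleExtension

/-! ### Cohomology in degree two -/

section DegreeTwo

lemma coboundary_two_apply {k G M : Type} [CommRing k] [Group G] [AddCommGroup M] [Module k M]
    (ρ : Representation k G M) (f : (Fin 2 → G) → M) (x y z : G) :
    coboundary ρ 2 f ![x, y, z] =
      ρ x (f ![y, z]) - f ![x * y, z] + f ![x, y * z] - f ![x, y] := by
  have h0 : (Fin.contractNth 0 (· * ·) ![x, y, z] : Fin 2 → G) = ![x * y, z] := by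
    funext l; fin_cases l <;> simp [Fin.contractNth]
  have h1 : (Fin.contractNth 1 (· * ·) ![x, y, z] : Fin 2 → G) = ![x, y * z] := by
    funext l; fin_cases l <;> simp [Fin.contractNth]
  have h2 : (Fin.contractNth 2 (· * ·) ![x, y, z] : Fin 2 → G) = ![x, y] := by
    funext l; fin_cases l <;> simp [Fin.contractNth]
  have h3 : Fin.tail ![x, y, z] = ![y, z] := by
    funext l; fin_cases l <;> rfl
  have h4 : (-1 : k) ^ 3 = -1 := by ring
  rw [coboundary_apply, Fin.sum_univ_three, h0, h1, h2, h3]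
  simp [h4]
  abel

lemma fin_two_eq {X : Type} (g : Fin 2 → X) : g = ![g 0, g 1] := by
  funext l; fin_cases l <;> rfl

lemma fin_three_eq {X : Type} (g : Fin 3 → X) : g = ![g 0, g 1, g 2] := by
  funext l; fin_cases l <;> rfl

variable {p : ℕ} [hp : Fact p.Prime]

/-- A locally constant cocycle lives on a finite `p`-quotient and defines an extension of it by
`ℤ/p`. The quotient map kills `N`, so it factors through the free group and lifts to the extension.
Minus the kernel component of the lift is a primitive, locally constant because the extension has
`p`-power order. -/
theorem contH_two_subsingleton : Subsingleton (ContH p (ProPCompletion p ShearAmalgam) 2) := by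
  refine contH_succ_subsingleton 1 fun f hf hd => ?_
  obtain ⟨U, hU, h⟩ := hf
  have := hU.1
  have := hU.isNilpotent
  let π := QuotientGroup.mk' U
  let F : ShearAmalgam ⧸ U → ShearAmalgam ⧸ U → ZMod p := fun x y => f ![x.out, y.out]
  have hF : ∀ x y, F (π x) (π y) = f ![x, y] := fun x y => h _ _ fun i => by
    fin_cases i <;> exact QuotientGroup.eq.1 (QuotientGroup.out_eq' _)
  have hcoc : ∀ x y z, F y z + F x (y * z) = F (x * y) z + F x y := by
    intro x y z
    obtain ⟨x, rfl⟩ := QuotientGroup.mk'_surjective U x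
    obtain ⟨y, rfl⟩ := QuotientGroup.mk'_surjective U y
    obtain ⟨z, rfl⟩ := QuotientGroup.mk'_surjective U z
    have h1 := congrFun hd ![x, y, z]
    rw [coboundary_two_apply] at h1
    rw [← map_mul, ← map_mul, hF, hF, hF, hF, ← sub_eq_zero]
    refine Eq.trans ?_ h1
    rw [Representation.trivial_apply]
    abel
  let θ : ShearAmalgam →* CocycleExtension F hcoc :=
    (FreeGroup.lift fun i => ⟨0, π (ShearAmalgam.stableLetter i)⟩).comp ShearAmalgam.toFree
  have hθ : ∀ x, (θ x).x = π x := by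
    -- Both maps take values in the nilpotent quotient, so they agree on the lattice automatically.
    have : CocycleExtension.proj.comp θ = π := ShearAmalgam.hom_ext
      (fun x => by
        rw [ShearAmalgam.map_lattice_of_isNilpotent, ShearAmalgam.map_lattice_of_isNilpotent])
      (fun i => by
        simp only [θ, MonoidHom.comp_apply, ShearAmalgam.toFree_stableLetter,
          FreeGroup.lift_apply_of]
        rfl)
    exact fun x => DFunLike.congr_fun this x
  obtain ⟨k, hk⟩ := hU.2
  have hker : IsPPowerIndex p θ.ker := isPPowerIndex_ker_of_card (a := k + 1) θ (by
    rw [CocycleExtension.card, Nat.card_zmod, pow_succ, mul_comm, ← hk]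
    rfl)
  refine ⟨fun g => -(θ (g 0)).a, ⟨_, hker, fun g g' hg => ?_⟩, funext fun g => ?_⟩
  · have h1 := MonoidHom.mem_ker.1 (hg 0)
    rw [map_mul, map_inv, inv_mul_eq_one] at h1
    simp only [h1]
  · rw [fin_two_eq g, coboundary_one_apply, Representation.trivial_apply, ← hF, ← hθ, ← hθ]
    simp only [Matrix.cons_val_zero, map_mul, CocycleExtension.mul_a]
    abel

end DegreeTwo

/-! ### A nontrivial class in degree two -/

namespace Heis

/-- The quadratic function `n (n - 1) / 2`. -/
def binomTwo (n : ℤ) : ℤ := n * (n - 1) / 2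

/-- A shear changes the cross term of the Heisenberg product by a symmetric term such as `x.v *
y.v`; this identity lets `binomTwo` absorb it, so the shears lift to automorphisms. -/
lemma binomTwo_add (m n : ℤ) : binomTwo (m + n) = binomTwo m + binomTwo n + m * n := by
  have h : ∀ n, 2 * binomTwo n = n * (n - 1) := fun n =>
    Int.mul_ediv_cancel' (Int.even_mul_pred_self n).two_dvd
  have := h (m + n)
  have := h m
  have := h n
  nlinarith

/-- Lifts of the shears to the Heisenberg group. -/
def shearLift : Fin 2 → MulAut (Heis ℤ)
  | 0 =>
    { toFun := fun x => ⟨x.u + x.v, x.v, x.w + binomTwo x.v⟩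
      invFun := fun x => ⟨x.u - x.v, x.v, x.w - binomTwo x.v⟩
      left_inv := fun x => by simp
      right_inv := fun x => by simp
      map_mul' := fun x y => by
        ext
        · simp; ring
        · simp
        · simp [binomTwo_add]; ring }
  | 1 =>
    { toFun := fun x => ⟨x.u, x.u + x.v, x.w + binomTwo x.u⟩
      invFun := fun x => ⟨x.u, x.v - x.u, x.w - binomTwo x.u⟩
      left_inv := fun x => by simp
      right_inv := fun x => by simp
      map_mul' := fun x y => by
        ext
        · simp
        · simp; ring
        · simp [binomTwo_add]; ring }

/-- The action of the free group on the Heisenberg group. -/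
def freeAction : FreeGroup (Fin 2) →* MulAut (Heis ℤ) := FreeGroup.lift shearLift

/-- The action of the free group on the lattice. -/
def latticeAction : FreeGroup (Fin 2) →* MulAut RankTwoLattice := FreeGroup.lift shear

lemma centralQuotient_freeAction (g : FreeGroup (Fin 2)) (x : Heis ℤ) :
    centralQuotient (freeAction g x) = latticeAction g (centralQuotient x) := by
  have hof : ∀ i x, centralQuotient (freeAction (FreeGroup.of i) x) =
      latticeAction (FreeGroup.of i) (centralQuotient x) := fun i x => by
    rw [freeAction, latticeAction, FreeGroup.lift_apply_of, FreeGroup.lift_apply_of]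
    fin_cases i <;> rfl
  induction g using FreeGroup.induction_on generalizing x with
  | C1 => simp
  | of i => exact hof i x
  | inv_of i _ =>
    rw [map_inv, map_inv, MulAut.inv_apply, MulAut.inv_apply, MulEquiv.eq_symm_apply, ← hof,
      MulEquiv.apply_symm_apply]
  | mul g h ihg ihh => rw [map_mul, map_mul, MulAut.mul_apply, MulAut.mul_apply, ihg, ihh]

lemma freeAction_central (g : FreeGroup (Fin 2)) (k : ℤ) :
    freeAction g ⟨0, 0, k⟩ = ⟨0, 0, k⟩ := by
  have hof : ∀ i, freeAction (FreeGroup.of i) ⟨0, 0, k⟩ = ⟨0, 0, k⟩ := fun i => by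
    rw [freeAction, FreeGroup.lift_apply_of]
    fin_cases i <;> simp [shearLift, binomTwo]
  induction g using FreeGroup.induction_on with
  | C1 => simp
  | of i => exact hof i
  | inv_of i _ => rw [map_inv, MulAut.inv_apply, MulEquiv.symm_apply_eq, hof]
  | mul g h ihg ihh => rw [map_mul, MulAut.mul_apply, ihh, ihg]

/-- The normalized section of the quotient by the center. -/
def centralSection (x : RankTwoLattice) : Heis ℤ := ⟨x.toAdd.1, x.toAdd.2, 0⟩

end Heis

/-! ### The central extension of `N ⋊ F₂` and its class -/

namespace ShearAmalgam

open Heis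

/-- The isomorphism of `G` with `N ⋊ F₂`, as a homomorphism. -/
def toSemidirect : ShearAmalgam →* RankTwoLattice ⋊[latticeAction] FreeGroup (Fin 2) :=
  Monoid.PushoutI.lift
    (fun i => SemidirectProduct.map (MonoidHom.id _) (zpowersHom _ (FreeGroup.of i)) fun g => by
      refine MonoidHom.ext fun x => ?_
      simp [latticeAction]) SemidirectProduct.inl
    (fun i => by
      refine MonoidHom.ext fun x => ?_
      simp)

/-- The 2-cocycle of the extension of `N ⋊ F₂` by `ℤ` with middle term `Heis ℤ ⋊ F₂`. -/
def extensionCocycle (x y : RankTwoLattice ⋊[latticeAction] FreeGroup (Fin 2)) : ℤ :=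
  (centralSection x.left * freeAction x.right (centralSection y.left)).w

lemma section_mul (x y : RankTwoLattice ⋊[latticeAction] FreeGroup (Fin 2)) :
    centralSection x.left * freeAction x.right (centralSection y.left) =
      centralSection (x * y).left * ⟨0, 0, extensionCocycle x y⟩ := by
  have h := centralQuotient_freeAction x.right (centralSection y.left)
  have hu : (freeAction x.right (centralSection y.left)).u = (latticeAction x.right y.left).toAdd.1 :=
    congrArg (fun z : RankTwoLattice => z.toAdd.1) h
  have hv : (freeAction x.right (centralSection y.left)).v = (latticeAction x.right y.left).toAdd.2 :=
    congrArg (fun z : RankTwoLattice => z.toAdd.2) h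
  ext
  · rw [mul_u, hu]
    simp [centralSection]
  · rw [mul_v, hv]
    simp [centralSection]
  · simp [centralSection, extensionCocycle]

/-- Associativity for the section, using that the free group acts trivially on the centre of the
Heisenberg group. -/
lemma extensionCocycle_cocycle (x y z : RankTwoLattice ⋊[latticeAction] FreeGroup (Fin 2)) :
    extensionCocycle y z + extensionCocycle x (y * z) =
      extensionCocycle (x * y) z + extensionCocycle x y := by
  have h1 : centralSection x.left * freeAction x.right (centralSection y.left *
      freeAction y.right (centralSection z.left)) = centralSection x.left *
      freeAction x.right (centralSection y.left) * freeAction (x * y).right (centralSection z.left) := by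
    rw [map_mul, SemidirectProduct.mul_right, map_mul, MulAut.mul_apply, mul_assoc]
  rw [section_mul, section_mul x y, map_mul, freeAction_central, ← mul_assoc, section_mul] at h1
  have hc : ∀ (k : ℤ) (a : Heis ℤ), ⟨0, 0, k⟩ * a = a * ⟨0, 0, k⟩ := fun k a => by
    ext <;> simp [add_comm]
  rw [mul_assoc (centralSection (x * y).left), hc,
    ← mul_assoc (centralSection (x * y).left) (freeAction _ _), section_mul (x * y) z, mul_assoc x y z] at h1
  have h2 := congrArg Heis.w h1
  simp only [mul_w, mul_u] at h2
  simp only [mul_zero, add_zero] at h2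
  linarith

variable {p : ℕ} [hp : Fact p.Prime]

/-- With trivial coefficients a 2-coboundary takes equal values on `(x, y)` and `(y, x)` when `x`
and `y` commute. On the two basis vectors of `N` the cocycle takes the values `1` and `0`, the
Heisenberg commutator. -/
theorem discH_two_nontrivial : Nontrivial (DiscH p ShearAmalgam 2) := by
  let f : (Fin 2 → ShearAmalgam) → ZMod p := fun g =>
    (extensionCocycle (toSemidirect (g 0)) (toSemidirect (g 1)) : ℤ)
  refine homology_nontrivial (C := groupCohomology.inhomogeneousCochains
    (Rep.trivial (ZMod p) ShearAmalgam (ZMod p))) 1 f ?_ ?_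
  · rw [groupCohomology.inhomogeneousCochains.d_def]
    change coboundary (Representation.trivial (ZMod p) ShearAmalgam (ZMod p)) 2 f = 0
    funext g
    rw [fin_three_eq g, coboundary_two_apply, Representation.trivial_apply, Pi.zero_apply]
    have := congrArg (Int.cast (R := ZMod p)) (extensionCocycle_cocycle (toSemidirect (g 0))
      (toSemidirect (g 1)) (toSemidirect (g 2)))
    push_cast at this
    simp only [f, Matrix.cons_val_zero, Matrix.cons_val_one, map_mul]
    linear_combination this
  · intro b hb
    rw [groupCohomology.inhomogeneousCochains.d_def] at hb
    change coboundary (Representation.trivial (ZMod p) ShearAmalgam (ZMod p)) 1 b = f at hb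
    let x : ShearAmalgam := lattice (Multiplicative.ofAdd (1, 0))
    let y : ShearAmalgam := lattice (Multiplicative.ofAdd (0, 1))
    have hxy : x * y = y * x := (map_mul lattice _ _).symm.trans
      ((congrArg lattice (mul_comm _ _)).trans (map_mul lattice _ _))
    have h1 := congrFun hb ![x, y]
    have h2 := congrFun hb ![y, x]
    rw [coboundary_one_apply, Representation.trivial_apply] at h1 h2
    have h3 : f ![x, y] = f ![y, x] := by
      rw [← h1, ← h2, hxy]
      ring
    have hx : ∀ n, toSemidirect (lattice n) = SemidirectProduct.inl n := fun n => by
      rw [toSemidirect, lattice, Monoid.PushoutI.lift_base]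
    have h4 : f ![x, y] = 1 := by
      simp [f, x, y, hx, extensionCocycle, centralSection]
    have h5 : f ![y, x] = 0 := by
      simp [f, x, y, hx, extensionCocycle, centralSection]
    rw [h4, h5] at h3
    exact one_ne_zero h3

end ShearAmalgam

/-! ### Failure of the class `𝒞` and conclusion -/

lemma not_isInClassC_shearAmalgam : ¬ IsInClassC ShearAmalgam := fun h => by
  -- One prime is enough: in degree two a surjection from zero would hit a nonzero group.
  have : Fact (Nat.Prime 2) := ⟨Nat.prime_two⟩
  have h1 : Subsingleton ((forget₂ (TopModuleCat (ZMod 2)) (ModuleCat (ZMod 2))).obj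
    (ContH 2 (ProPCompletion 2 ShearAmalgam) 2)) := contH_two_subsingleton
  have h2 := (h 2 Nat.prime_two 2).surjective.subsingleton
  exact not_subsingleton_iff_nontrivial.2 ShearAmalgam.discH_two_nontrivial h2

theorem mainTheorem10 :
    -- `G₁ ≅ G₂` are finitely generated, torsion-free, nilpotent of class 2
    Nonempty (ShearGroup 0 ≃* ShearGroup 1) ∧
    (∀ i : Fin 2, Group.FG (ShearGroup i) ∧
      (∀ x : ShearGroup i, x ≠ 1 → ¬ IsOfFinOrder x) ∧
      ∃ _ : Group.IsNilpotent (ShearGroup i), Group.nilpotencyClass (ShearGroup i) = 2) ∧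
    -- the hypotheses of the two criteria other than "central", respectively "cyclic", hold
    Group.FG RankTwoLattice ∧
    (∀ i : Fin 2, IsInClassC (ShearGroup i ⧸ (latticeInclusion i).range)) ∧
    (∀ i : Fin 2, IsInClassC (ShearGroup i)) ∧
    (∀ i : Fin 2, ∀ p : ℕ, p.Prime → IsResiduallyPFinite p (ShearGroup i)) ∧
    -- the amalgamated subgroup is neither central nor cyclic
    (∀ i : Fin 2, ¬ (latticeInclusion i).range ≤ Subgroup.center (ShearGroup i)) ∧
    ¬ IsCyclic RankTwoLattice ∧
    -- the cohomology of `G = G₁ *_N G₂` and of its pro-`p` completion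
    (∀ p : ℕ, p.Prime →
      Nonempty (ProPCompletion p ShearAmalgam ≃ₜ* ProPCompletion p (FreeGroup (Fin 2))) ∧
      Subsingleton (ContH p (ProPCompletion p ShearAmalgam) 2) ∧
      Nontrivial (DiscH p ShearAmalgam 2)) ∧
    ¬ IsInClassC ShearAmalgam := by
  refine ⟨⟨shearGroupZeroEquiv.trans shearGroupOneEquiv.symm⟩, fun i => ?_, inferInstance,
    isInClassC_shearGroup_quotient, isInClassC_shearGroup, fun i p hp => ?_, not_range_le_center,
    not_isCyclic_rankTwoLattice, fun p hp => ?_, not_isInClassC_shearAmalgam⟩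
  · obtain ⟨e⟩ := nonempty_shearGroup_mulEquiv i
    exact ⟨Group.fg_of_surjective (f := e.symm.toMonoidHom) e.symm.surjective,
      fun x hx h => Heis.not_isOfFinOrder ((map_ne_one_iff e e.injective).2 hx)
        (e.toMonoidHom.isOfFinOrder h), Heis.exists_nilpotencyClass_eq_two e⟩
  · have : Fact p.Prime := ⟨hp⟩
    obtain ⟨e⟩ := nonempty_shearGroup_mulEquiv i
    exact isResiduallyPFinite_of_mulEquiv e Heis.isResiduallyPFinite
  · have : Fact p.Prime := ⟨hp⟩
    exact ⟨⟨ShearAmalgam.completionEquiv⟩, contH_two_subsingleton,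
      ShearAmalgam.discH_two_nontrivial⟩
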